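/- Let $\mathbf{Rel}$ be the strict monoidal category whose objects are the finite ordinals $n=\{0,\dots,n-1\}$ ($n\in\mathbb{N}$), whose morphisms $m\to n$ are the relations $R\subseteq m\times n$ with relational composition, and whose tensor product is addition on objects and disjoint union on morphisms. Let $\mathfrak{R}$ be the monoidal equational theory of *qualitative bicommutative bialgebras*: it has one generator for objects $1$, five generators for morphisms $$\mu:2\to 1,\qquad \eta:0\to 1,\qquad \delta:1\to 2,\qquad \varepsilon:1\to 0,\qquad \gamma:2\to 2,$$ and the following relations (writing $1$ also for $\mathrm{id}_1$): * symmetry: $(\gamma\otimes 1)\circ(1\otimes\gamma)\circ(\gamma\otimes 1)=(1\otimes\gamma)\circ(\gamma\otimes 1)\circ(1\otimes\gamma)$ and $\gamma\circ\gamma=\mathrm{id}_2$; * commutative monoid: $\mu\circ(\mu\otimes 1)=\mu\circ(1\otimes\mu)$, $\mu\circ(\eta\otimes 1)=1=\mu\circ(1\otimes\eta)$, $\gamma\circ(\mu\otimes 1)=(1\otimes\mu)\circ(\gamma\otimes 1)\circ(1\otimes\gamma)$, $\gamma\circ(1\otimes\mu)=(\mu\otimes 1)\circ(1\otimes\gamma)\circ(\gamma\otimes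 1)$, $\gamma\circ(\eta\otimes 1)=1\otimes\eta$, $\gamma\circ(1\otimes\eta)=\eta\otimes 1$, $\mu\circ\gamma=\mu$; * cocommutative comonoid: the eight dual relations $(\delta\otimes 1)\circ\delta=(1\otimes\delta)\circ\delta$, $(\varepsilon\otimes 1)\circ\delta=1=(1\otimes\varepsilon)\circ\delta$, $(\delta\otimes 1)\circ\gamma=(1\otimes\gamma)\circ(\gamma\otimes 1)\circ(1\otimes\delta)$, $(1\otimes\delta)\circ\gamma=(\gamma\otimes 1)\circ(1\otimes\gamma)\circ(\delta\otimes 1)$, $(\varepsilon\otimes 1)\circ\gamma=1\otimes\varepsilon$, $(1\otimes\varepsilon)\circ\gamma=\varepsilon\otimes 1$, $\gamma\circ\delta=\delta$; * bialgebra: $\delta\circ\mu=(\mu\otimes\mu)\circ(1\otimes\gamma\otimes 1)\circ(\delta\otimes\delta)$, $\varepsilon\circ\mu=\varepsilon\otimes\varepsilon$, $\delta\circ\eta=\eta\otimes\eta$, $\varepsilon\circ\eta=\mathrm{id}_0$; * qualitativity: $\mu\circ\delta=\mathrm{id}_1$. **Theorem.** The monoidal category $\mathbf{Rel}$ is presented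 by $\mathfrak{R}$. That is, let $\mathbb{R}$ be the quotient of the free strict monoidal category on the generators of $\mathfrak{R}$ by the smallest congruence (with respect to composition and tensor product) containing the relations of $\mathfrak{R}$. Then $\mathbb{R}$ and $\mathbf{Rel}$ are monoidally equivalent: there are strict monoidal functors $F:\mathbb{R}\to\mathbf{Rel}$ and $G:\mathbf{Rel}\to\mathbb{R}$ and invertible monoidal natural transformations $\mathrm{Id}_{\mathbb{R}}\to GF$ and $FG\to\mathrm{Id}_{\mathbf{Rel}}$. -/

import Mathlib

open CategoryTheory MonoidalCategory

universe v u w v₁ v₂ u₁ u₂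

/-! ### Strict monoidal categories, strict monoidal functors, monoidal equivalence -/

/-- A monoidal category is strict when its associators and unitors are identities. -/
class IsStrictMonoidal (C : Type u) [Category.{v} C] [MonoidalCategory C] : Prop where
  tensor_assoc : ∀ X Y Z : C, (X ⊗ Y) ⊗ Z = X ⊗ (Y ⊗ Z)
  unit_tensor : ∀ X : C, 𝟙_ C ⊗ X = X
  tensor_unit : ∀ X : C, X ⊗ 𝟙_ C = X
  associator_eq : ∀ X Y Z : C, (α_ X Y Z).hom = eqToHom (tensor_assoc X Y Z)
  leftUnitor_eq : ∀ X : C, (λ_ X).hom = eqToHom (unit_tensor X)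
  rightUnitor_eq : ∀ X : C, (ρ_ X).hom = eqToHom (tensor_unit X)

/-- A monoidal functor is strict when it preserves unit and tensor product on the nose, i.e. when
its structure morphisms `ε` and `μ` are identities. -/
class IsStrictMonoidalFunctor {C : Type u₁} {D : Type u₂} [Category.{v₁} C] [Category.{v₂} D]
    [MonoidalCategory C] [MonoidalCategory D] (F : C ⥤ D) [F.Monoidal] : Prop where
  obj_unit : 𝟙_ D = F.obj (𝟙_ C)
  obj_tensor : ∀ X Y : C, F.obj X ⊗ F.obj Y = F.obj (X ⊗ Y)
  ε_eq : Functor.LaxMonoidal.ε F = eqToHom obj_unit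
  μ_eq : ∀ X Y : C, Functor.LaxMonoidal.μ F X Y = eqToHom (obj_tensor X Y)

/-- Two strict monoidal categories are monoidally equivalent when there are strict monoidal
functors in both directions and invertible monoidal natural transformations between their
composites and the identity functors. -/
def MonoidallyEquivalent (C : Type u₁) (D : Type u₂) [Category.{v₁} C] [Category.{v₂} D]
    [MonoidalCategory C] [MonoidalCategory D] [IsStrictMonoidal C] [IsStrictMonoidal D] : Prop :=
  ∃ (F : C ⥤ D) (G : D ⥤ C) (_ : F.Monoidal) (_ : G.Monoidal),
    IsStrictMonoidalFunctor F ∧ IsStrictMonoidalFunctor G ∧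
    ∃ (η : 𝟭 C ≅ F ⋙ G) (ε : G ⋙ F ≅ 𝟭 D),
      NatTrans.IsMonoidal η.hom ∧ NatTrans.IsMonoidal ε.hom

/-- The usual data and laws of a strict monoidal structure, used to build instances of
`MonoidalCategory`. -/
structure StrictTensor (C : Type u) [Category.{v} C] where
  obj : C → C → C
  unit : C
  hom : ∀ {X₁ Y₁ X₂ Y₂ : C}, (X₁ ⟶ Y₁) → (X₂ ⟶ Y₂) → (obj X₁ X₂ ⟶ obj Y₁ Y₂)
  id_hom_id : ∀ X Y : C, hom (𝟙 X) (𝟙 Y) = 𝟙 (obj X Y)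
  hom_comp_hom : ∀ {X₁ Y₁ Z₁ X₂ Y₂ Z₂ : C} (f₁ : X₁ ⟶ Y₁) (f₂ : X₂ ⟶ Y₂) (g₁ : Y₁ ⟶ Z₁)
    (g₂ : Y₂ ⟶ Z₂), hom f₁ f₂ ≫ hom g₁ g₂ = hom (f₁ ≫ g₁) (f₂ ≫ g₂)
  obj_assoc : ∀ X Y Z : C, obj (obj X Y) Z = obj X (obj Y Z)
  unit_obj : ∀ X : C, obj unit X = X
  obj_unit : ∀ X : C, obj X unit = X
  hom_assoc : ∀ {X₁ Y₁ X₂ Y₂ X₃ Y₃ : C} (f₁ : X₁ ⟶ Y₁) (f₂ : X₂ ⟶ Y₂) (f₃ : X₃ ⟶ Y₃),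
    HEq (hom (hom f₁ f₂) f₃) (hom f₁ (hom f₂ f₃))
  unit_hom : ∀ {X Y : C} (f : X ⟶ Y), HEq (hom (𝟙 unit) f) f
  hom_unit : ∀ {X Y : C} (f : X ⟶ Y), HEq (hom f (𝟙 unit)) f

namespace StrictTensor

variable {C : Type u} [Category.{v} C]

theorem comp_eqToHom_of_heq {X Y X' Y' : C} {f : X ⟶ Y} {g : X' ⟶ Y'} (hX : X = X') (hY : Y = Y')
    (h : HEq f g) : f ≫ eqToHom hY = eqToHom hX ≫ g := by
  subst hX hY
  simpa using eq_of_heq h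

variable (S : StrictTensor C)

theorem hom_eqToHom_id {X Y Z : C} (h : X = Y) :
    S.hom (eqToHom h) (𝟙 Z) = eqToHom (congrArg (fun W => S.obj W Z) h) := by
  subst h
  simpa using S.id_hom_id X Z

theorem hom_id_eqToHom {X Y Z : C} (h : X = Y) :
    S.hom (𝟙 Z) (eqToHom h) = eqToHom (congrArg (fun W => S.obj Z W) h) := by
  subst h
  simpa using S.id_hom_id Z X

theorem pentagon (W X Y Z : C) :
    S.hom (eqToHom (S.obj_assoc W X Y)) (𝟙 Z) ≫ eqToHom (S.obj_assoc W (S.obj X Y) Z) ≫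
        S.hom (𝟙 W) (eqToHom (S.obj_assoc X Y Z)) =
      eqToHom (S.obj_assoc (S.obj W X) Y Z) ≫ eqToHom (S.obj_assoc W X (S.obj Y Z)) := by
  rw [hom_eqToHom_id, hom_id_eqToHom]
  simp only [eqToHom_trans]

theorem triangle (X Y : C) :
    eqToHom (S.obj_assoc X S.unit Y) ≫ S.hom (𝟙 X) (eqToHom (S.unit_obj Y)) =
      S.hom (eqToHom (S.obj_unit X)) (𝟙 Y) := by
  rw [hom_eqToHom_id, hom_id_eqToHom]
  simp only [eqToHom_trans]

/-- The underlying data: tensor product as given, structural isomorphisms identities. -/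
abbrev toStruct : MonoidalCategoryStruct C where
  tensorObj := S.obj
  tensorUnit := S.unit
  tensorHom f g := S.hom f g
  whiskerLeft X _ _ f := S.hom (𝟙 X) f
  whiskerRight f Y := S.hom f (𝟙 Y)
  associator X Y Z := eqToIso (S.obj_assoc X Y Z)
  leftUnitor X := eqToIso (S.unit_obj X)
  rightUnitor X := eqToIso (S.obj_unit X)

/-- The monoidal category given by a strict tensor product. -/
abbrev toMonoidal : MonoidalCategory C :=
  letI := S.toStruct
  MonoidalCategory.ofTensorHom
    (id_tensorHom_id := S.id_hom_id)
    (id_tensorHom := fun _ _ _ _ => rfl)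
    (tensorHom_id := fun _ _ => rfl)
    (tensorHom_comp_tensorHom := S.hom_comp_hom)
    (associator_naturality := fun f₁ f₂ f₃ =>
      comp_eqToHom_of_heq (S.obj_assoc _ _ _) (S.obj_assoc _ _ _) (S.hom_assoc f₁ f₂ f₃))
    (leftUnitor_naturality := fun f => comp_eqToHom_of_heq (S.unit_obj _) (S.unit_obj _) (S.unit_hom f))
    (rightUnitor_naturality := fun f => comp_eqToHom_of_heq (S.obj_unit _) (S.obj_unit _) (S.hom_unit f))
    (pentagon := S.pentagon)
    (triangle := S.triangle)

theorem isStrictMonoidal : @IsStrictMonoidal C _ S.toMonoidal :=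
  letI := S.toMonoidal
  { tensor_assoc := S.obj_assoc
    unit_tensor := S.unit_obj
    tensor_unit := S.obj_unit
    associator_eq := fun _ _ _ => rfl
    leftUnitor_eq := fun _ => rfl
    rightUnitor_eq := fun _ => rfl }

end StrictTensor

/-! ### Signatures and the free strict monoidal category on a signature -/

/-- A signature: generators for objects, and generators for morphisms with a source and a target
in the free monoid on the generators for objects. -/
structure MonSignature where
  Ob : Type u
  Gen : Type w
  s : Gen → FreeMonoid Ob
  t : Gen → FreeMonoid Ob

namespace MonSignature

variable (S : MonSignature.{u, w})

/-- Formal composites and tensor products of generators. -/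
inductive Term : FreeMonoid S.Ob → FreeMonoid S.Ob → Type (max u w)
  | gen (g : S.Gen) : Term (S.s g) (S.t g)
  | id (A : FreeMonoid S.Ob) : Term A A
  | comp {A B C : FreeMonoid S.Ob} (f : Term A B) (g : Term B C) : Term A C
  | tensor {A B C D : FreeMonoid S.Ob} (f : Term A B) (g : Term C D) : Term (A * C) (B * D)

variable {S}

/-- Transport of a term along equalities of its source and its target. -/
def Term.cast {A B A' B' : FreeMonoid S.Ob} (hA : A = A') (hB : B = B') (f : Term S A B) :
    Term S A' B' :=
  hA ▸ hB ▸ f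

/-- The congruence generated by the laws of strict monoidal categories. -/
inductive Term.Eqv : ∀ {A B : FreeMonoid S.Ob}, Term S A B → Term S A B → Prop
  | refl {A B} (f : Term S A B) : Eqv f f
  | symm {A B} {f g : Term S A B} : Eqv f g → Eqv g f
  | trans {A B} {f g h : Term S A B} : Eqv f g → Eqv g h → Eqv f h
  | comp_congr {A B C} {f f' : Term S A B} {g g' : Term S B C} :
      Eqv f f' → Eqv g g' → Eqv (f.comp g) (f'.comp g')
  | tensor_congr {A B C D} {f f' : Term S A B} {g g' : Term S C D} :
      Eqv f f' → Eqv g g' → Eqv (f.tensor g) (f'.tensor g')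
  | id_comp {A B} (f : Term S A B) : Eqv ((Term.id A).comp f) f
  | comp_id {A B} (f : Term S A B) : Eqv (f.comp (Term.id B)) f
  | comp_assoc {A B C D} (f : Term S A B) (g : Term S B C) (h : Term S C D) :
      Eqv ((f.comp g).comp h) (f.comp (g.comp h))
  | id_tensor_id (A B : FreeMonoid S.Ob) :
      Eqv ((Term.id A).tensor (Term.id B)) (Term.id (A * B))
  | tensor_comp_tensor {A₁ B₁ C₁ A₂ B₂ C₂} (f₁ : Term S A₁ B₁) (f₂ : Term S A₂ B₂)
      (g₁ : Term S B₁ C₁) (g₂ : Term S B₂ C₂) :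
      Eqv ((f₁.tensor f₂).comp (g₁.tensor g₂)) ((f₁.comp g₁).tensor (f₂.comp g₂))
  | tensor_assoc {A₁ B₁ A₂ B₂ A₃ B₃} (f₁ : Term S A₁ B₁) (f₂ : Term S A₂ B₂)
      (f₃ : Term S A₃ B₃) :
      Eqv (((f₁.tensor f₂).tensor f₃).cast (mul_assoc _ _ _) (mul_assoc _ _ _))
        (f₁.tensor (f₂.tensor f₃))
  | unit_tensor {A B} (f : Term S A B) :
      Eqv (((Term.id 1).tensor f).cast (one_mul _) (one_mul _)) f
  | tensor_unit {A B} (f : Term S A B) :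
      Eqv ((f.tensor (Term.id 1)).cast (mul_one _) (mul_one _)) f

/-- Terms up to the laws of strict monoidal categories. -/
instance Term.setoid (A B : FreeMonoid S.Ob) : Setoid (Term S A B) where
  r := Term.Eqv
  iseqv := ⟨Term.Eqv.refl, Term.Eqv.symm, Term.Eqv.trans⟩

variable (S)

/-- The free strict monoidal category on a signature. Its objects are the elements of the free
monoid on the generators for objects. -/
def Free : Type u := FreeMonoid S.Ob

instance : Category S.Free where
  Hom A B := Quotient (Term.setoid (S := S) A B)
  id A := Quotient.mk _ (Term.id A)
  comp := Quotient.map₂ Term.comp (fun _ _ h _ _ h' => Term.Eqv.comp_congr h h')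
  id_comp := by rintro _ _ ⟨f⟩; exact Quotient.sound (Term.Eqv.id_comp f)
  comp_id := by rintro _ _ ⟨f⟩; exact Quotient.sound (Term.Eqv.comp_id f)
  assoc := by rintro _ _ _ _ ⟨f⟩ ⟨g⟩ ⟨h⟩; exact Quotient.sound (Term.Eqv.comp_assoc f g h)

variable {S}

theorem Term.heq_of_cast {A B A' B' : FreeMonoid S.Ob} {f : Term S A B} {g : Term S A' B'}
    (hA : A = A') (hB : B = B') (h : Term.Eqv (f.cast hA hB) g) :
    HEq (Quotient.mk (Term.setoid A B) f) (Quotient.mk (Term.setoid A' B') g) := by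
  subst hA hB
  exact heq_of_eq (Quotient.sound h)

variable (S)

/-- The tensor product of the free strict monoidal category: concatenation on objects, formal
tensor product on morphisms. -/
def freeTensor : StrictTensor S.Free where
  obj A B := HMul.hMul (α := FreeMonoid S.Ob) (β := FreeMonoid S.Ob) A B
  unit := (1 : FreeMonoid S.Ob)
  hom := Quotient.map₂ Term.tensor (fun _ _ h _ _ h' => Term.Eqv.tensor_congr h h')
  id_hom_id A B := Quotient.sound (Term.Eqv.id_tensor_id A B)
  hom_comp_hom := by
    rintro _ _ _ _ _ _ ⟨f₁⟩ ⟨f₂⟩ ⟨g₁⟩ ⟨g₂⟩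
    exact Quotient.sound (Term.Eqv.tensor_comp_tensor f₁ f₂ g₁ g₂)
  obj_assoc A B C := mul_assoc (G := FreeMonoid S.Ob) A B C
  unit_obj A := one_mul (M := FreeMonoid S.Ob) A
  obj_unit A := mul_one (M := FreeMonoid S.Ob) A
  hom_assoc := by
    rintro _ _ _ _ _ _ ⟨f₁⟩ ⟨f₂⟩ ⟨f₃⟩
    exact Term.heq_of_cast _ _ (Term.Eqv.tensor_assoc f₁ f₂ f₃)
  unit_hom := by
    rintro _ _ ⟨f⟩
    exact Term.heq_of_cast _ _ (Term.Eqv.unit_tensor f)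
  hom_unit := by
    rintro _ _ ⟨f⟩
    exact Term.heq_of_cast _ _ (Term.Eqv.tensor_unit f)

instance : MonoidalCategory S.Free := S.freeTensor.toMonoidal

instance : IsStrictMonoidal S.Free := S.freeTensor.isStrictMonoidal

variable {S}

/-- A generator, seen as a morphism of the free strict monoidal category. -/
def gen (g : S.Gen) : @Quiver.Hom S.Free _ (S.s g) (S.t g) :=
  Quotient.mk (Term.setoid (S := S) (S.s g) (S.t g)) (Term.gen g)

end MonSignature

/-! ### Monoidal equational theories and presentations -/

/-- A pair of morphisms with the same source and the same target. -/
structure ParallelPair (C : Type u) [Category.{v} C] where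
  {src : C}
  {tgt : C}
  lhs : src ⟶ tgt
  rhs : src ⟶ tgt

/-- A monoidal equational theory: a signature and a family of pairs of parallel morphisms of the
free strict monoidal category on it. -/
structure MonTheory extends MonSignature.{u, w} where
  Idx : Type v
  rel : Idx → ParallelPair toMonSignature.Free

namespace MonTheory

variable (T : MonTheory.{v, u, w})

/-- The smallest congruence, with respect to composition and tensor product, that identifies the
two sides of every relation of the theory. -/
inductive Cong : ∀ {A B : T.toMonSignature.Free}, (A ⟶ B) → (A ⟶ B) → Prop
  | of (e : T.Idx) : Cong (T.rel e).lhs (T.rel e).rhs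
  | refl {A B} (f : A ⟶ B) : Cong f f
  | symm {A B} {f g : A ⟶ B} : Cong f g → Cong g f
  | trans {A B} {f g h : A ⟶ B} : Cong f g → Cong g h → Cong f h
  | comp_congr {A B C} {f f' : A ⟶ B} {g g' : B ⟶ C} :
      Cong f f' → Cong g g' → Cong (f ≫ g) (f' ≫ g')
  | tensor_congr {A B C D} {f f' : A ⟶ B} {g g' : C ⟶ D} :
      Cong f f' → Cong g g' → Cong (f ⊗ₘ g) (f' ⊗ₘ g')

/-- Morphisms of the free category up to the congruence generated by the relations. -/
instance congSetoid (A B : T.toMonSignature.Free) : Setoid (A ⟶ B) where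
  r := T.Cong
  iseqv := ⟨Cong.refl, Cong.symm, Cong.trans⟩

/-- The monoidal category generated by a theory: the free strict monoidal category on its
signature, with morphisms taken up to the congruence generated by its relations. -/
def Generated : Type u := T.toMonSignature.Free

instance : Category T.Generated where
  Hom A B := Quotient (T.congSetoid A B)
  id A := Quotient.mk (T.congSetoid A A) (CategoryStruct.id (obj := T.toMonSignature.Free) A)
  comp := Quotient.map₂ (fun f g => f ≫ g) (fun _ _ h _ _ h' => Cong.comp_congr h h')
  id_comp := by rintro _ _ ⟨f⟩; exact congrArg (Quotient.mk _) (Category.id_comp f)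
  comp_id := by rintro _ _ ⟨f⟩; exact congrArg (Quotient.mk _) (Category.comp_id f)
  assoc := by
    rintro _ _ _ _ ⟨f⟩ ⟨g⟩ ⟨h⟩
    exact congrArg (Quotient.mk _) (Category.assoc f g h)

theorem heq_mk {A B A' B' : T.toMonSignature.Free} {f : A ⟶ B} {g : A' ⟶ B'}
    (hA : A = A') (hB : B = B') (h : HEq f g) :
    HEq (Quotient.mk (T.congSetoid A B) f) (Quotient.mk (T.congSetoid A' B') g) := by
  subst hA hB
  exact heq_of_eq (congrArg _ (eq_of_heq h))

/-- The tensor product of the generated category, induced by that of the free category. -/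
def generatedTensor : StrictTensor T.Generated where
  obj := T.toMonSignature.freeTensor.obj
  unit := T.toMonSignature.freeTensor.unit
  hom := Quotient.map₂ T.toMonSignature.freeTensor.hom (fun _ _ h _ _ h' => Cong.tensor_congr h h')
  id_hom_id A B := congrArg (Quotient.mk _) (T.toMonSignature.freeTensor.id_hom_id A B)
  hom_comp_hom := by
    rintro _ _ _ _ _ _ ⟨f₁⟩ ⟨f₂⟩ ⟨g₁⟩ ⟨g₂⟩
    exact congrArg (Quotient.mk _) (T.toMonSignature.freeTensor.hom_comp_hom f₁ f₂ g₁ g₂)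
  obj_assoc := T.toMonSignature.freeTensor.obj_assoc
  unit_obj := T.toMonSignature.freeTensor.unit_obj
  obj_unit := T.toMonSignature.freeTensor.obj_unit
  hom_assoc := by
    rintro _ _ _ _ _ _ ⟨f₁⟩ ⟨f₂⟩ ⟨f₃⟩
    exact T.heq_mk (T.toMonSignature.freeTensor.obj_assoc _ _ _)
      (T.toMonSignature.freeTensor.obj_assoc _ _ _)
      (T.toMonSignature.freeTensor.hom_assoc f₁ f₂ f₃)
  unit_hom := by
    rintro _ _ ⟨f⟩
    exact T.heq_mk (T.toMonSignature.freeTensor.unit_obj _)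
      (T.toMonSignature.freeTensor.unit_obj _) (T.toMonSignature.freeTensor.unit_hom f)
  hom_unit := by
    rintro _ _ ⟨f⟩
    exact T.heq_mk (T.toMonSignature.freeTensor.obj_unit _)
      (T.toMonSignature.freeTensor.obj_unit _) (T.toMonSignature.freeTensor.hom_unit f)

instance : MonoidalCategory T.Generated := T.generatedTensor.toMonoidal

instance : IsStrictMonoidal T.Generated := T.generatedTensor.isStrictMonoidal

/-- A theory presents a strict monoidal category when the category it generates is monoidally
equivalent to that category. -/
def Presents (M : Type u₁) [Category.{v₁} M] [MonoidalCategory M] [IsStrictMonoidal M] : Prop :=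
  MonoidallyEquivalent T.Generated M

end MonTheory

/-! ### The theory of qualitative bicommutative bialgebras -/

namespace Bialg

/-- The generators for morphisms of the theory of bialgebras. -/
inductive Gen : Type
  | mu | eta | delta | eps | gamma

/-- The object `1`, generating the free monoid of objects. -/
abbrev one : FreeMonoid Unit := FreeMonoid.of ()

/-- The signature with one generator for objects `1` and five generators for morphisms
`μ : 2 → 1`, `η : 0 → 1`, `δ : 1 → 2`, `ε : 1 → 0` and `γ : 2 → 2`. -/
def sig : MonSignature.{0, 0} where
  Ob := Unit
  Gen := Gen
  s
    | .mu => one * one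
    | .eta => 1
    | .delta => one
    | .eps => one
    | .gamma => one * one
  t
    | .mu => one
    | .eta => one
    | .delta => one * one
    | .eps => 1
    | .gamma => one * one

/-- The generating object. -/
def X : sig.Free := one

/-- The multiplication. -/
def μ : X ⊗ X ⟶ X := MonSignature.gen (S := sig) Gen.mu

/-- The unit. -/
def η : 𝟙_ sig.Free ⟶ X := MonSignature.gen (S := sig) Gen.eta

/-- The comultiplication. -/
def δ : X ⟶ X ⊗ X := MonSignature.gen (S := sig) Gen.delta

/-- The counit. -/
def ε : X ⟶ 𝟙_ sig.Free := MonSignature.gen (S := sig) Gen.eps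

/-- The symmetry. -/
def γ : X ⊗ X ⟶ X ⊗ X := MonSignature.gen (S := sig) Gen.gamma

/-- Names of the twenty-two relations of the theory of bicommutative bialgebras. -/
inductive RelName : Type
  | yangBaxter | symSym
  | mulAssoc | unitMul | mulUnit | mulSymLeft | mulSymRight | unitSymLeft | unitSymRight | mulComm
  | comulCoassoc | counitComul | comulCounit | comulSymLeft | comulSymRight
  | counitSymLeft | counitSymRight | comulCocomm
  | mulComul | mulCounit | unitComul | unitCounit

/-- The twenty-two relations of the theory of bicommutative bialgebras. The structural
isomorphisms `α_`, `λ_`, `ρ_` are identities, the category being strict. -/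
def rel : RelName → ParallelPair sig.Free
  | .yangBaxter =>
      ⟨γ ▷ X ≫ (α_ X X X).hom ≫ X ◁ γ ≫ (α_ X X X).inv ≫ γ ▷ X,
        (α_ X X X).hom ≫ X ◁ γ ≫ (α_ X X X).inv ≫ γ ▷ X ≫ (α_ X X X).hom ≫ X ◁ γ ≫
          (α_ X X X).inv⟩
  | .symSym => ⟨γ ≫ γ, 𝟙 (X ⊗ X)⟩
  | .mulAssoc => ⟨μ ▷ X ≫ μ, (α_ X X X).hom ≫ X ◁ μ ≫ μ⟩
  | .unitMul => ⟨(λ_ X).inv ≫ η ▷ X ≫ μ, 𝟙 X⟩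
  | .mulUnit => ⟨(ρ_ X).inv ≫ X ◁ η ≫ μ, 𝟙 X⟩
  | .mulSymLeft =>
      ⟨μ ▷ X ≫ γ,
        (α_ X X X).hom ≫ X ◁ γ ≫ (α_ X X X).inv ≫ γ ▷ X ≫ (α_ X X X).hom ≫ X ◁ μ⟩
  | .mulSymRight =>
      ⟨X ◁ μ ≫ γ,
        (α_ X X X).inv ≫ γ ▷ X ≫ (α_ X X X).hom ≫ X ◁ γ ≫ (α_ X X X).inv ≫ μ ▷ X⟩
  | .unitSymLeft => ⟨(λ_ X).inv ≫ η ▷ X ≫ γ, (ρ_ X).inv ≫ X ◁ η⟩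
  | .unitSymRight => ⟨(ρ_ X).inv ≫ X ◁ η ≫ γ, (λ_ X).inv ≫ η ▷ X⟩
  | .mulComm => ⟨γ ≫ μ, μ⟩
  | .comulCoassoc => ⟨δ ≫ δ ▷ X, δ ≫ X ◁ δ ≫ (α_ X X X).inv⟩
  | .counitComul => ⟨δ ≫ ε ▷ X ≫ (λ_ X).hom, 𝟙 X⟩
  | .comulCounit => ⟨δ ≫ X ◁ ε ≫ (ρ_ X).hom, 𝟙 X⟩
  | .comulSymLeft =>
      ⟨γ ≫ δ ▷ X,
        X ◁ δ ≫ (α_ X X X).inv ≫ γ ▷ X ≫ (α_ X X X).hom ≫ X ◁ γ ≫ (α_ X X X).inv⟩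
  | .comulSymRight =>
      ⟨γ ≫ X ◁ δ,
        δ ▷ X ≫ (α_ X X X).hom ≫ X ◁ γ ≫ (α_ X X X).inv ≫ γ ▷ X ≫ (α_ X X X).hom⟩
  | .counitSymLeft => ⟨γ ≫ ε ▷ X ≫ (λ_ X).hom, X ◁ ε ≫ (ρ_ X).hom⟩
  | .counitSymRight => ⟨γ ≫ X ◁ ε ≫ (ρ_ X).hom, ε ▷ X ≫ (λ_ X).hom⟩
  | .comulCocomm => ⟨δ ≫ γ, δ⟩
  | .mulComul =>
      ⟨μ ≫ δ,
        (δ ⊗ₘ δ) ≫ (α_ X X (X ⊗ X)).hom ≫ X ◁ (α_ X X X).inv ≫ X ◁ (γ ▷ X) ≫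
          X ◁ (α_ X X X).hom ≫ (α_ X X (X ⊗ X)).inv ≫ (μ ⊗ₘ μ)⟩
  | .mulCounit => ⟨μ ≫ ε, (ε ⊗ₘ ε) ≫ (λ_ (𝟙_ sig.Free)).hom⟩
  | .unitComul => ⟨η ≫ δ, (λ_ (𝟙_ sig.Free)).inv ≫ (η ⊗ₘ η)⟩
  | .unitCounit => ⟨η ≫ ε, 𝟙 (𝟙_ sig.Free)⟩

/-- The equational theory of bicommutative bialgebras. -/
def theory : MonTheory.{0, 0, 0} where
  toMonSignature := sig
  Idx := RelName
  rel := rel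

/-- The equational theory of qualitative bicommutative bialgebras: the theory of bicommutative
bialgebras with the additional relation `μ ∘ δ = id`, indexed by `none`. -/
def qualitativeTheory : MonTheory.{0, 0, 0} where
  toMonSignature := sig
  Idx := Option RelName
  rel
    | none => ⟨δ ≫ μ, 𝟙 X⟩
    | some e => rel e

end Bialg

/-! ### The category of finite ordinals and relations -/

/-- The objects of the category of finite ordinals and relations: `n` stands for the finite
ordinal `{0, …, n - 1}`. -/
def FinOrdRel : Type := ℕ

namespace FinOrdRel

/-- Morphisms `m ⟶ n` are relations between `Fin m` and `Fin n`, with relational composition. -/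
instance : Category FinOrdRel where
  Hom m n := Fin m → Fin n → Prop
  id _ := Eq
  comp R S := Relation.Comp R S
  id_comp _ := Relation.eq_comp
  comp_id _ := Relation.comp_eq
  assoc _ _ _ := Relation.comp_assoc

/-- The disjoint union of two relations, `Fin (m + n)` being the disjoint union of `Fin m`,
placed first, and `Fin n`. -/
def sumRel {m n m' n' : ℕ} (R : Fin m → Fin n → Prop) (R' : Fin m' → Fin n' → Prop) :
    Fin (m + m') → Fin (n + n') → Prop :=
  fun i j => Sum.LiftRel R R' (finSumFinEquiv.symm i) (finSumFinEquiv.symm j)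

theorem sumRel_iff {m n m' n' : ℕ} (R : Fin m → Fin n → Prop) (R' : Fin m' → Fin n' → Prop)
    (i : Fin (m + m')) (j : Fin (n + n')) :
    sumRel R R' i j ↔
      (∃ (a : Fin m) (b : Fin n), (i : ℕ) = a ∧ (j : ℕ) = b ∧ R a b) ∨
      (∃ (a : Fin m') (b : Fin n'), (i : ℕ) = m + a ∧ (j : ℕ) = n + b ∧ R' a b) := by
  obtain ⟨x, rfl⟩ := finSumFinEquiv.surjective i
  obtain ⟨y, rfl⟩ := finSumFinEquiv.surjective j
  simp only [sumRel, Equiv.symm_apply_apply]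
  constructor
  · rintro (h | h)
    · exact Or.inl ⟨_, _, by simp, by simp, h⟩
    · exact Or.inr ⟨_, _, by simp, by simp, h⟩
  · rcases x with x | x <;> rcases y with y | y <;>
      rintro (⟨a, b, ha, hb, h⟩ | ⟨a, b, ha, hb, h⟩) <;>
      simp only [finSumFinEquiv_apply_left, finSumFinEquiv_apply_right, Fin.val_castAdd,
        Fin.val_natAdd] at ha hb
    · obtain rfl := Fin.ext ha
      obtain rfl := Fin.ext hb
      exact .inl h
    all_goals first
      | (exfalso; omega)
      | skip
    obtain rfl : x = a := Fin.ext (by omega)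
    obtain rfl : y = b := Fin.ext (by omega)
    exact .inr h

theorem heq_of_iff {m n m' n' : ℕ} {R : Fin m → Fin n → Prop} {R' : Fin m' → Fin n' → Prop}
    (hm : m = m') (hn : n = n')
    (h : ∀ (i : Fin m) (j : Fin n), R i j ↔ R' (i.cast hm) (j.cast hn)) : HEq R R' := by
  subst hm hn
  exact heq_of_eq (funext fun i => funext fun j => propext (h i j))

theorem sumRel_eq (m n : ℕ) : sumRel (@Eq (Fin m)) (@Eq (Fin n)) = Eq := by
  funext i j
  obtain ⟨x, rfl⟩ := finSumFinEquiv.surjective i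
  obtain ⟨y, rfl⟩ := finSumFinEquiv.surjective j
  simp only [sumRel, Equiv.symm_apply_apply, EmbeddingLike.apply_eq_iff_eq]
  rcases x with x | x <;> rcases y with y | y <;> simp

theorem sumRel_comp {m n p m' n' p' : ℕ} (R : Fin m → Fin n → Prop) (R' : Fin m' → Fin n' → Prop)
    (S : Fin n → Fin p → Prop) (S' : Fin n' → Fin p' → Prop) :
    Relation.Comp (sumRel R R') (sumRel S S') =
      sumRel (Relation.Comp R S) (Relation.Comp R' S') := by
  funext i k
  obtain ⟨x, rfl⟩ := finSumFinEquiv.surjective i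
  obtain ⟨z, rfl⟩ := finSumFinEquiv.surjective k
  simp only [Relation.Comp, sumRel, Equiv.symm_apply_apply]
  rw [finSumFinEquiv.symm.exists_congr_left]
  rcases x with x | x <;> rcases z with z | z <;> simp [Relation.Comp]

theorem sumRel_assoc {m n m' n' m'' n'' : ℕ} (R : Fin m → Fin n → Prop)
    (R' : Fin m' → Fin n' → Prop) (R'' : Fin m'' → Fin n'' → Prop) :
    HEq (sumRel (sumRel R R') R'') (sumRel R (sumRel R' R'')) := by
  refine heq_of_iff (Nat.add_assoc _ _ _) (Nat.add_assoc _ _ _) fun i j => ?_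
  simp only [sumRel_iff, Fin.val_cast]
  constructor
  · rintro (⟨a, b, ha, hb, (⟨c, d, hc, hd, h⟩ | ⟨c, d, hc, hd, h⟩)⟩ | ⟨a, b, ha, hb, h⟩)
    · exact Or.inl ⟨c, d, by omega, by omega, h⟩
    · exact Or.inr ⟨Fin.castAdd _ c, Fin.castAdd _ d, by simp; omega, by simp; omega,
        Or.inl ⟨c, d, by simp, by simp, h⟩⟩
    · exact Or.inr ⟨Fin.natAdd _ a, Fin.natAdd _ b, by simp; omega, by simp; omega,
        Or.inr ⟨a, b, by simp, by simp, h⟩⟩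
  · rintro (⟨a, b, ha, hb, h⟩ | ⟨a, b, ha, hb, (⟨c, d, hc, hd, h⟩ | ⟨c, d, hc, hd, h⟩)⟩)
    · exact Or.inl ⟨Fin.castAdd _ a, Fin.castAdd _ b, by simp; omega, by simp; omega,
        Or.inl ⟨a, b, by simp, by simp, h⟩⟩
    · exact Or.inl ⟨Fin.natAdd _ c, Fin.natAdd _ d, by simp; omega, by simp; omega,
        Or.inr ⟨c, d, by simp, by simp, h⟩⟩
    · exact Or.inr ⟨c, d, by omega, by omega, h⟩

theorem unit_sumRel {m n : ℕ} (R : Fin m → Fin n → Prop) :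
    HEq (sumRel (@Eq (Fin 0)) R) R := by
  refine heq_of_iff (Nat.zero_add _) (Nat.zero_add _) fun i j => ?_
  rw [sumRel_iff]
  constructor
  · rintro (⟨a, _⟩ | ⟨a, b, ha, hb, h⟩)
    · exact a.elim0
    · convert h using 1 <;> ext <;> simp [ha, hb]
  · exact fun h => Or.inr ⟨_, _, by simp, by simp, h⟩

theorem sumRel_unit {m n : ℕ} (R : Fin m → Fin n → Prop) :
    HEq (sumRel R (@Eq (Fin 0))) R := by
  refine heq_of_iff (Nat.add_zero _) (Nat.add_zero _) fun i j => ?_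
  rw [sumRel_iff]
  constructor
  · rintro (⟨a, b, ha, hb, h⟩ | ⟨a, _⟩)
    · convert h using 1 <;> ext <;> simp [ha, hb]
    · exact a.elim0
  · exact fun h => Or.inl ⟨_, _, by simp, by simp, h⟩

/-- The tensor product of relations: addition on objects, disjoint union on morphisms. -/
def tensor : StrictTensor FinOrdRel where
  obj m n := HAdd.hAdd (α := ℕ) (β := ℕ) m n
  unit := (0 : ℕ)
  hom R R' := sumRel R R'
  id_hom_id m n := sumRel_eq m n
  hom_comp_hom R₁ R₂ S₁ S₂ := sumRel_comp R₁ R₂ S₁ S₂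
  obj_assoc := Nat.add_assoc
  unit_obj := Nat.zero_add
  obj_unit := Nat.add_zero
  hom_assoc R₁ R₂ R₃ := sumRel_assoc R₁ R₂ R₃
  unit_hom R := unit_sumRel R
  hom_unit R := sumRel_unit R

instance : MonoidalCategory FinOrdRel := tensor.toMonoidal

instance : IsStrictMonoidal FinOrdRel := tensor.isStrictMonoidal

end FinOrdRel

/-!
The swap, the deletion and the copying of the generating object extend to all objects factor by
factor, and the relations say exactly that the five generators slide past the swap and commute with
copying and deleting; hence so do all morphisms. The presented category is therefore symmetric with
uniform copying and deleting, that is, cartesian, and a morphism is determined by its components,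
which are morphisms to the generating object. By qualitativity these form idempotent commutative
monoids, and every one of them is the product of a set of projections, since precomposing with a
generator preserves such products. The set is the set of inputs related to the component, so
morphisms of the presented category are the same as relations.
-/

section StrictMonoidal

variable {C : Type u₁} {D : Type u₂} [Category.{v₁} C] [Category.{v₂} D]

section

variable [MonoidalCategory C] [MonoidalCategory D]

theorem eqToHom_tensorHom_eqToHom {X Y X' Y' : C} (h : X = Y) (h' : X' = Y') :
    eqToHom h ⊗ₘ eqToHom h' = eqToHom (by rw [h, h'] : X ⊗ X' = Y ⊗ Y') := by
  subst h h'
  simp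

theorem eqToHom_conj_tensorHom {X X' Y Y' Z W : C} (hX : X' = X) (hY : Y = Y') (f : X ⟶ Y)
    (g : Z ⟶ W) :
    (eqToHom hX ≫ f ≫ eqToHom hY) ⊗ₘ g =
      eqToHom (by rw [hX]) ≫ (f ⊗ₘ g) ≫ eqToHom (by rw [hY]) := by
  subst hX hY
  simp

theorem tensorHom_eqToHom_conj {X Y Z Z' W W' : C} (hZ : Z' = Z) (hW : W = W') (f : X ⟶ Y)
    (g : Z ⟶ W) :
    f ⊗ₘ (eqToHom hZ ≫ g ≫ eqToHom hW) =
      eqToHom (by rw [hZ]) ≫ (f ⊗ₘ g) ≫ eqToHom (by rw [hW]) := by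
  subst hZ hW
  simp

theorem IsStrictMonoidal.associator_inv_eq [IsStrictMonoidal C] (X Y Z : C) :
    (α_ X Y Z).inv = eqToHom (tensor_assoc X Y Z).symm := by
  rw [← cancel_epi (α_ X Y Z).hom, Iso.hom_inv_id, associator_eq]
  simp

theorem IsStrictMonoidal.id_tensorHom_of_unit_eq [IsStrictMonoidal C] {U X Y : C}
    (hU : 𝟙_ C = U) (f : X ⟶ Y) :
    𝟙 U ⊗ₘ f =
      eqToHom (by rw [← hU, unit_tensor]) ≫ f ≫ eqToHom (by rw [← hU, unit_tensor]) := by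
  subst hU
  rw [← Category.assoc, ← leftUnitor_eq, id_tensorHom, ← leftUnitor_naturality, leftUnitor_eq]
  simp

theorem IsStrictMonoidal.tensorHom_id_of_unit_eq [IsStrictMonoidal C] {U X Y : C}
    (hU : 𝟙_ C = U) (f : X ⟶ Y) :
    f ⊗ₘ 𝟙 U =
      eqToHom (by rw [← hU, tensor_unit]) ≫ f ≫ eqToHom (by rw [← hU, tensor_unit]) := by
  subst hU
  rw [← Category.assoc, ← rightUnitor_eq, tensorHom_id, ← rightUnitor_naturality, rightUnitor_eq]
  simp

namespace IsStrictMonoidalFunctor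

section OfTensorHom

variable [IsStrictMonoidal C] [IsStrictMonoidal D] (F : C ⥤ D) (hunit : 𝟙_ D = F.obj (𝟙_ C))
  (htensor : ∀ X Y : C, F.obj X ⊗ F.obj Y = F.obj (X ⊗ Y))
  (hmap : ∀ {X Y X' Y' : C} (f : X ⟶ Y) (g : X' ⟶ Y'),
    (F.map f ⊗ₘ F.map g) ≫ eqToHom (htensor Y Y') = eqToHom (htensor X X') ≫ F.map (f ⊗ₘ g))

/-- The monoidal structure, with identities as structure morphisms, on a functor between strict
monoidal categories that commutes with tensor products. -/
abbrev monoidalOfTensorHom : F.Monoidal :=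
  Functor.CoreMonoidal.toMonoidal
    { εIso := eqToIso hunit
      μIso := fun X Y => eqToIso (htensor X Y)
      μIso_hom_natural_left := fun f X => by simpa using hmap f (𝟙 X)
      μIso_hom_natural_right := fun X f => by simpa using hmap (𝟙 X) f
      associativity := fun X Y Z => by
        simp [IsStrictMonoidal.associator_eq, eqToHom_map, eqToHom_whiskerRight,
          whiskerLeft_eqToHom]
      left_unitality := fun X => by
        simp [IsStrictMonoidal.leftUnitor_eq, eqToHom_map, eqToHom_whiskerRight]
      right_unitality := fun X => by
        simp [IsStrictMonoidal.rightUnitor_eq, eqToHom_map, whiskerLeft_eqToHom] }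

theorem of_tensorHom :
    letI := monoidalOfTensorHom F hunit htensor hmap
    IsStrictMonoidalFunctor F :=
  letI := monoidalOfTensorHom F hunit htensor hmap
  { obj_unit := hunit
    obj_tensor := htensor
    ε_eq := rfl
    μ_eq := fun _ _ => rfl }

end OfTensorHom

theorem map_tensorHom (F : C ⥤ D) [F.Monoidal] [IsStrictMonoidalFunctor F] {X Y X' Y' : C}
    (f : X ⟶ Y) (g : X' ⟶ Y') :
    F.map (f ⊗ₘ g) =
      eqToHom (obj_tensor (F := F) X X').symm ≫ (F.map f ⊗ₘ F.map g) ≫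
        eqToHom (obj_tensor (F := F) Y Y') := by
  rw [← μ_eq, Functor.LaxMonoidal.μ_natural, μ_eq]
  simp

instance : IsStrictMonoidalFunctor (𝟭 C) where
  obj_unit := rfl
  obj_tensor _ _ := rfl
  ε_eq := rfl
  μ_eq _ _ := rfl

instance {E : Type u} [Category.{v} E] [MonoidalCategory E] (F : C ⥤ D) (G : D ⥤ E) [F.Monoidal]
    [G.Monoidal] [IsStrictMonoidalFunctor F] [IsStrictMonoidalFunctor G] :
    IsStrictMonoidalFunctor (F ⋙ G) where
  obj_unit := (obj_unit (F := G)).trans (congrArg G.obj (obj_unit (F := F)))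
  obj_tensor X Y := (obj_tensor (F := G) _ _).trans (congrArg G.obj (obj_tensor (F := F) X Y))
  ε_eq := by simp [Functor.LaxMonoidal.comp_ε, ε_eq, eqToHom_map]
  μ_eq X Y := by simp [Functor.LaxMonoidal.comp_μ, μ_eq, eqToHom_map]

theorem isMonoidal_of_app_eq_eqToHom {F G : C ⥤ D} [F.Monoidal] [G.Monoidal]
    [IsStrictMonoidalFunctor F] [IsStrictMonoidalFunctor G] (τ : F ⟶ G)
    (h : ∀ X, F.obj X = G.obj X) (hτ : ∀ X, τ.app X = eqToHom (h X)) : NatTrans.IsMonoidal τ where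
  unit := by simp [ε_eq, hτ]
  tensor X Y := by simp [μ_eq, hτ, eqToHom_tensorHom_eqToHom]

end IsStrictMonoidalFunctor

end

/-- The functor inverting a fully faithful functor `F` along a right inverse of `F` on objects. -/
noncomputable def objectwiseInverse (F : C ⥤ D) [F.Full] [F.Faithful] {g : D → C}
    (hg : Function.RightInverse g F.obj) : D ⥤ C where
  obj := g
  map {Y Z} f := F.preimage (eqToHom (hg Y) ≫ f ≫ eqToHom (hg Z).symm)
  map_id Y := F.map_injective (by simp)
  map_comp f f' := F.map_injective (by simp)

namespace objectwiseInverse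

variable (F : C ⥤ D) [F.Full] [F.Faithful] {g : D → C} (hg : Function.RightInverse g F.obj)
  (hg' : Function.LeftInverse g F.obj)

theorem obj_obj (Y : D) : F.obj ((objectwiseInverse F hg).obj Y) = Y :=
  hg Y

include hg' in
theorem obj_obj_of_leftInverse (X : C) : (objectwiseInverse F hg).obj (F.obj X) = X :=
  hg' X

theorem map_map {Y Z : D} (f : Y ⟶ Z) :
    F.map ((objectwiseInverse F hg).map f) =
      eqToHom (obj_obj F hg Y) ≫ f ≫ eqToHom (obj_obj F hg Z).symm :=
  F.map_preimage _

/-- Applying `F` to its inverse on objects is isomorphic to the identity, via identities. -/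
noncomputable def counitIso : objectwiseInverse F hg ⋙ F ≅ 𝟭 D :=
  NatIso.ofComponents (fun Y => eqToIso (obj_obj F hg Y)) fun f => by simp [map_map]

/-- The identity is isomorphic, via identities, to `F` followed by its inverse on objects. -/
noncomputable def unitIso : 𝟭 C ≅ F ⋙ objectwiseInverse F hg :=
  NatIso.ofComponents (fun X => eqToIso (obj_obj_of_leftInverse F hg hg' X).symm) fun f =>
    F.map_injective (by simp [map_map, eqToHom_map])

variable [MonoidalCategory C] [MonoidalCategory D] [F.Monoidal] [IsStrictMonoidalFunctor F]

include hg'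

theorem obj_unit : 𝟙_ C = (objectwiseInverse F hg).obj (𝟙_ D) := by
  rw [IsStrictMonoidalFunctor.obj_unit (F := F), obj_obj_of_leftInverse F hg hg']

theorem obj_tensor (Y Z : D) :
    (objectwiseInverse F hg).obj Y ⊗ (objectwiseInverse F hg).obj Z =
      (objectwiseInverse F hg).obj (Y ⊗ Z) := by
  rw [← obj_obj_of_leftInverse F hg hg' (_ ⊗ _), ← IsStrictMonoidalFunctor.obj_tensor, obj_obj,
    obj_obj]

theorem map_tensorHom {Y Z Y' Z' : D} (f : Y ⟶ Z) (f' : Y' ⟶ Z') :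
    ((objectwiseInverse F hg).map f ⊗ₘ (objectwiseInverse F hg).map f') ≫
        eqToHom (obj_tensor F hg hg' Z Z') =
      eqToHom (obj_tensor F hg hg' Y Y') ≫ (objectwiseInverse F hg).map (f ⊗ₘ f') := by
  apply F.map_injective
  simp [IsStrictMonoidalFunctor.map_tensorHom, map_map, ← tensorHom_comp_tensorHom,
    eqToHom_tensorHom_eqToHom, eqToHom_map]

end objectwiseInverse

theorem monoidallyEquivalent_of_bijective_obj [MonoidalCategory C] [MonoidalCategory D]
    [IsStrictMonoidal C] [IsStrictMonoidal D]
    (F : C ⥤ D) [F.Monoidal] [IsStrictMonoidalFunctor F] [F.Full] [F.Faithful]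
    (hF : Function.Bijective F.obj) : MonoidallyEquivalent C D := by
  obtain ⟨g, hg', hg⟩ := Function.bijective_iff_has_inverse.1 hF
  let := IsStrictMonoidalFunctor.monoidalOfTensorHom (objectwiseInverse F hg)
    (objectwiseInverse.obj_unit F hg hg') (objectwiseInverse.obj_tensor F hg hg')
    (objectwiseInverse.map_tensorHom F hg hg')
  have : IsStrictMonoidalFunctor (objectwiseInverse F hg) :=
    IsStrictMonoidalFunctor.of_tensorHom _ _ _ _
  exact ⟨F, objectwiseInverse F hg, inferInstance, inferInstance, inferInstance, inferInstance,
    objectwiseInverse.unitIso F hg hg', objectwiseInverse.counitIso F hg,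
    IsStrictMonoidalFunctor.isMonoidal_of_app_eq_eqToHom _ (fun X => (hg' X).symm) fun _ => rfl,
    IsStrictMonoidalFunctor.isMonoidal_of_app_eq_eqToHom _ hg fun _ => rfl⟩

end StrictMonoidal

namespace MonSignature

variable {S : MonSignature.{u, w}}

/-- An interpretation of a signature in a monoidal category `D`: an object for every word in the
generators for objects, compatibly with concatenation up to equality, and a morphism for every
generator for morphisms. Words, rather than single generators, are interpreted so that a
concatenation can be sent to a convenient representative of the tensor product. -/
structure Interpretation (S : MonSignature.{u, w}) (D : Type u₂) [Category.{v₂} D]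
    [MonoidalCategory D] where
  obj : FreeMonoid S.Ob → D
  obj_one : 𝟙_ D = obj 1
  obj_mul : ∀ A B, obj A ⊗ obj B = obj (A * B)
  gen : ∀ g, obj (S.s g) ⟶ obj (S.t g)

namespace Interpretation

variable {D : Type u₂} [Category.{v₂} D] [MonoidalCategory D] (I : S.Interpretation D)

/-- The value of a formal composite of generators under an interpretation. -/
def termMap : ∀ {A B : FreeMonoid S.Ob}, Term S A B → (I.obj A ⟶ I.obj B)
  | _, _, .gen g => I.gen g
  | _, _, .id A => 𝟙 (I.obj A)
  | _, _, .comp f g => termMap f ≫ termMap g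
  | _, _, .tensor f g =>
      eqToHom (I.obj_mul _ _).symm ≫ (termMap f ⊗ₘ termMap g) ≫ eqToHom (I.obj_mul _ _)

theorem termMap_cast {A B A' B' : FreeMonoid S.Ob} (hA : A = A') (hB : B = B') (f : Term S A B) :
    I.termMap (f.cast hA hB) =
      eqToHom (congrArg I.obj hA).symm ≫ I.termMap f ≫ eqToHom (congrArg I.obj hB) := by
  subst hA hB
  simp [Term.cast]

variable [IsStrictMonoidal D]

theorem termMap_eq_of_eqv {A B : FreeMonoid S.Ob} {f g : Term S A B} (h : f.Eqv g) :
    I.termMap f = I.termMap g := by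
  induction h with
  | refl => rfl
  | symm _ ih => exact ih.symm
  | trans _ _ ih ih' => exact ih.trans ih'
  | comp_congr _ _ ih ih' => simp only [termMap, ih, ih']
  | tensor_congr _ _ ih ih' => simp only [termMap, ih, ih']
  | id_comp => exact Category.id_comp _
  | comp_id => exact Category.comp_id _
  | comp_assoc => exact Category.assoc _ _ _
  | id_tensor_id => simp [termMap]
  | tensor_comp_tensor => simp [termMap]
  | tensor_assoc =>
    simp [termMap_cast, termMap, eqToHom_conj_tensorHom, tensorHom_eqToHom_conj,
      IsStrictMonoidal.associator_eq, IsStrictMonoidal.associator_inv_eq]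
  | unit_tensor =>
    simp [termMap_cast, termMap, IsStrictMonoidal.id_tensorHom_of_unit_eq I.obj_one,
      -id_tensorHom]
  | tensor_unit =>
    simp [termMap_cast, termMap, IsStrictMonoidal.tensorHom_id_of_unit_eq I.obj_one,
      -tensorHom_id]

/-- The functor from the free strict monoidal category extending an interpretation. -/
def functor : S.Free ⥤ D where
  obj := I.obj
  map := Quotient.lift I.termMap fun _ _ => I.termMap_eq_of_eqv
  map_id _ := rfl
  map_comp := by
    rintro _ _ _ ⟨f⟩ ⟨g⟩
    rfl

theorem functor_map_tensorHom {A B A' B' : S.Free} (f : A ⟶ B) (g : A' ⟶ B') :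
    I.functor.map (f ⊗ₘ g) =
      eqToHom (I.obj_mul _ _).symm ≫ (I.functor.map f ⊗ₘ I.functor.map g) ≫
        eqToHom (I.obj_mul _ _) := by
  obtain ⟨f⟩ := f
  obtain ⟨g⟩ := g
  rfl

end Interpretation

end MonSignature

namespace MonTheory

variable {T : MonTheory.{v, u, w}}

/-- A model of a theory: an interpretation of its signature satisfying its relations. -/
structure Model (T : MonTheory.{v, u, w}) (D : Type u₂) [Category.{v₂} D] [MonoidalCategory D]
    [IsStrictMonoidal D] extends T.toMonSignature.Interpretation D where
  map_rel : ∀ e, toInterpretation.functor.map (T.rel e).lhs =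
    toInterpretation.functor.map (T.rel e).rhs

namespace Model

variable {D : Type u₂} [Category.{v₂} D] [MonoidalCategory D] [IsStrictMonoidal D] (M : T.Model D)

theorem map_eq_of_cong {A B : T.toMonSignature.Free} {f g : A ⟶ B} (h : T.Cong f g) :
    M.toInterpretation.functor.map f = M.toInterpretation.functor.map g := by
  induction h with
  | of e => exact M.map_rel e
  | refl => rfl
  | symm _ ih => exact ih.symm
  | trans _ _ ih ih' => exact ih.trans ih'
  | comp_congr _ _ ih ih' => simp only [Functor.map_comp, ih, ih']
  | tensor_congr _ _ ih ih' =>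
    rw [MonSignature.Interpretation.functor_map_tensorHom, ih, ih',
      ← MonSignature.Interpretation.functor_map_tensorHom]

/-- The functor from the category generated by a theory classifying a model of it. -/
def functor : T.Generated ⥤ D where
  obj := M.obj
  map := Quotient.lift M.toInterpretation.functor.map fun _ _ => M.map_eq_of_cong
  map_id _ := rfl
  map_comp := by
    rintro _ _ _ ⟨f⟩ ⟨g⟩
    exact M.toInterpretation.functor.map_comp f g

theorem map_tensorHom_map {A B A' B' : T.Generated} (f : A ⟶ B) (g : A' ⟶ B') :
    (M.functor.map f ⊗ₘ M.functor.map g) ≫ eqToHom (M.obj_mul B B') =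
      eqToHom (M.obj_mul A A') ≫ M.functor.map (f ⊗ₘ g) := by
  obtain ⟨f⟩ := f
  obtain ⟨g⟩ := g
  exact (eqToHom_comp_iff _ _ _).1 (M.toInterpretation.functor_map_tensorHom f g).symm

instance : M.functor.Monoidal :=
  IsStrictMonoidalFunctor.monoidalOfTensorHom M.functor M.obj_one M.obj_mul M.map_tensorHom_map

instance : IsStrictMonoidalFunctor M.functor :=
  IsStrictMonoidalFunctor.of_tensorHom M.functor M.obj_one M.obj_mul M.map_tensorHom_map

end Model

end MonTheory

namespace FinOrdRel

/-- The natural number underlying a finite ordinal. -/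
def size (n : FinOrdRel) : ℕ := n

variable {m n p m' n' : FinOrdRel}

theorem size_tensorObj : (m ⊗ n).size = m.size + n.size :=
  rfl

/-- `Holds R i j` says that `R` relates `i` to `j`. Taking `i` and `j` in `ℕ` rather than in
`Fin m` and `Fin n` makes relations between propositionally equal ordinals comparable. -/
def Holds (R : m ⟶ n) (i j : ℕ) : Prop :=
  ∃ (hi : i < m.size) (hj : j < n.size), R ⟨i, hi⟩ ⟨j, hj⟩

theorem holds_val {R : m ⟶ n} {i : Fin m.size} {j : Fin n.size} : Holds R i j ↔ R i j :=
  ⟨fun ⟨_, _, h⟩ => h, fun h => ⟨i.isLt, j.isLt, h⟩⟩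

theorem Holds.lt_left {R : m ⟶ n} {i j : ℕ} (h : Holds R i j) : i < m.size :=
  h.1

theorem Holds.lt_right {R : m ⟶ n} {i j : ℕ} (h : Holds R i j) : j < n.size :=
  h.2.1

theorem hom_ext_holds {R S : m ⟶ n}
    (h : ∀ i < m.size, ∀ j < n.size, Holds R i j ↔ Holds S i j) : R = S :=
  funext fun (i : Fin m.size) => funext fun (j : Fin n.size) =>
    propext (holds_val.symm.trans ((h i i.isLt j j.isLt).trans holds_val))

theorem holds_eqToHom (h : m = n) {i j : ℕ} : Holds (eqToHom h) i j ↔ i < m.size ∧ i = j := by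
  subst h
  constructor
  · rintro ⟨hi, _, h⟩
    exact ⟨hi, congrArg Fin.val h⟩
  · rintro ⟨hi, rfl⟩
    exact ⟨hi, hi, rfl⟩

theorem holds_eqToHom_conj (hm : m' = m) (hn : n = n') {R : m ⟶ n} {i j : ℕ} :
    Holds (eqToHom hm ≫ R ≫ eqToHom hn) i j ↔ Holds R i j := by
  subst hm hn
  simp

theorem holds_id {i j : ℕ} : Holds (𝟙 m) i j ↔ i < m.size ∧ i = j :=
  holds_eqToHom rfl

theorem holds_comp {R : m ⟶ n} {S : n ⟶ p} {i k : ℕ} :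
    Holds (R ≫ S) i k ↔ ∃ j < n.size, Holds R i j ∧ Holds S j k := by
  constructor
  · rintro ⟨hi, hk, (j : Fin n.size), hR, hS⟩
    exact ⟨j, j.isLt, ⟨hi, j.isLt, hR⟩, ⟨j.isLt, hk, hS⟩⟩
  · rintro ⟨j, _, ⟨hi, _, hR⟩, ⟨_, hk, hS⟩⟩
    exact ⟨hi, hk, _, hR, hS⟩

theorem holds_tensorHom {R : m ⟶ n} {R' : m' ⟶ n'} {i j : ℕ} :
    Holds (R ⊗ₘ R') i j ↔
      Holds R i j ∨ m.size ≤ i ∧ n.size ≤ j ∧ Holds R' (i - m.size) (j - n.size) := by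
  constructor
  · rintro ⟨hi, hj, h⟩
    obtain ⟨a, b, rfl, rfl, hab⟩ | ⟨a, b, hia, hjb, hab⟩ := (sumRel_iff R R' _ _).1 h
    · exact .inl ⟨a.isLt, b.isLt, hab⟩
    · obtain rfl : i = m.size + a.val := hia
      obtain rfl : j = n.size + b.val := hjb
      refine .inr ⟨Nat.le_add_right _ _, Nat.le_add_right _ _, ?_⟩
      rw [Nat.add_sub_cancel_left, Nat.add_sub_cancel_left]
      exact ⟨a.isLt, b.isLt, hab⟩
  · rintro (⟨hi, hj, h⟩ | ⟨hi, hj, hi', hj', h⟩)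
    · exact ⟨Nat.lt_add_right _ hi, Nat.lt_add_right _ hj,
        (sumRel_iff R R' _ _).2 (.inl ⟨_, _, rfl, rfl, h⟩)⟩
    · have hi'' := Nat.add_sub_of_le hi
      have hj'' := Nat.add_sub_of_le hj
      exact ⟨(by rw [size_tensorObj]; omega), (by rw [size_tensorObj]; omega),
        (sumRel_iff R R' _ _).2 (.inr ⟨⟨_, hi'⟩, ⟨_, hj'⟩, hi''.symm, hj''.symm, h⟩)⟩

instance decidableHoldsComp (R : m ⟶ n) (S : n ⟶ p) [DecidableRel (Holds R)]
    [DecidableRel (Holds S)] : DecidableRel (Holds (R ≫ S)) :=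
  fun _ _ => decidable_of_iff _ holds_comp.symm

instance decidableHoldsTensorHom (R : m ⟶ n) (R' : m' ⟶ n') [DecidableRel (Holds R)]
    [DecidableRel (Holds R')] : DecidableRel (Holds (R ⊗ₘ R')) :=
  fun _ _ => decidable_of_iff _ holds_tensorHom.symm

instance decidableHoldsEqToHom (h : m = n) : DecidableRel (Holds (eqToHom h)) :=
  fun _ _ => decidable_of_iff _ (holds_eqToHom h).symm

instance decidableEqHom (R S : m ⟶ n) [DecidableRel (Holds R)] [DecidableRel (Holds S)] :
    Decidable (R = S) :=
  decidable_of_iff _ ⟨hom_ext_holds, by rintro rfl; simp⟩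

variable {S : MonSignature.{u, w}} (I : S.Interpretation FinOrdRel)
  [∀ g, DecidableRel (Holds (I.gen g))]

instance decidableHoldsTermMap : ∀ {A B : FreeMonoid S.Ob} (f : S.Term A B),
    DecidableRel (Holds (I.termMap f))
  | _, _, .gen g => inferInstanceAs (DecidableRel (Holds (I.gen g)))
  | _, _, .id A => decidableHoldsEqToHom rfl
  | _, _, .comp f g =>
    have := decidableHoldsTermMap f
    have := decidableHoldsTermMap g
    decidableHoldsComp _ _
  | _, _, .tensor f g =>
    have := decidableHoldsTermMap f
    have := decidableHoldsTermMap g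
    inferInstanceAs (DecidableRel (Holds (_ ≫ (I.termMap f ⊗ₘ I.termMap g) ≫ _)))

instance decidableHoldsFunctorMap {A B : S.Free} (f : A ⟶ B) :
    DecidableRel (Holds (I.functor.map f)) :=
  fun i j => Quotient.recOnSubsingleton f
    (motive := fun f => Decidable (Holds (I.functor.map f) i j)) fun t =>
      decidableHoldsTermMap I t i j

end FinOrdRel

namespace Bialg

open FinOrdRel

/-- The interpretation of the generators of the theory of bialgebras as relations: `μ`, `δ` relate
everything, `η`, `ε` are empty and `γ` is the transposition. -/
def relInterpretation : sig.Interpretation FinOrdRel where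
  obj := FreeMonoid.length
  obj_one := rfl
  obj_mul A B := (List.length_append (as := A) (bs := B)).symm
  gen
    | .mu => fun _ _ => True
    | .eta => fun i _ => i.elim0
    | .delta => fun _ _ => True
    | .eps => fun _ j => j.elim0
    | .gamma => fun i j => (i : Fin 2) ≠ j

instance : ∀ g, DecidableRel (Holds (relInterpretation.gen g))
  | .mu, _, _ => inferInstanceAs (Decidable (∃ (_ : _) (_ : _), True))
  | .eta, _, _ => isFalse (fun h => Nat.not_lt_zero _ h.lt_left)
  | .delta, _, _ => inferInstanceAs (Decidable (∃ (_ : _) (_ : _), True))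
  | .eps, _, _ => isFalse (fun h => Nat.not_lt_zero _ h.lt_right)
  | .gamma, i, j =>
    inferInstanceAs (Decidable (∃ (hi : i < 2) (hj : j < 2), (⟨i, hi⟩ : Fin 2) ≠ ⟨j, hj⟩))

-- Both sides are relations between explicit finite ordinals, hence comparable by evaluation.
theorem relInterpretation_map_rel (e : RelName) :
    relInterpretation.functor.map (rel e).lhs = relInterpretation.functor.map (rel e).rhs := by
  cases e <;> decide +kernel

theorem relInterpretation_map_delta_mu :
    relInterpretation.functor.map (δ ≫ μ) = relInterpretation.functor.map (𝟙 X) := by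
  decide +kernel

/-- The finite ordinals and relations as a model of the theory of qualitative bialgebras. -/
def relModel : qualitativeTheory.Model FinOrdRel where
  __ := relInterpretation
  map_rel
    | none => relInterpretation_map_delta_mu
    | some e => relInterpretation_map_rel e

end Bialg

namespace MonTheory

variable {T : MonTheory.{v, u, w}}

/-- A generator for objects, as an object of the generated category. -/
def of (x : T.Ob) : T.Generated :=
  FreeMonoid.of x

/-- The morphism of the generated category represented by a morphism of the free one. -/
def cls {A B : T.toMonSignature.Free} (f : A ⟶ B) : @Quiver.Hom T.Generated _ A B :=
  Quotient.mk (T.congSetoid A B) f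

theorem cls_rel (e : T.Idx) : cls (T.rel e).lhs = cls (T.rel e).rhs :=
  Quotient.sound (Cong.of e)

/-- A generator for morphisms, as a morphism of the generated category. -/
def genHom (g : T.Gen) : @Quiver.Hom T.Generated _ (T.s g) (T.t g) :=
  cls (MonSignature.gen g)

/-- Recursion on the number of factors of an object of a generated category. -/
@[elab_as_elim]
def objRec {P : T.Generated → Sort*} (one : P (𝟙_ T.Generated))
    (cons : ∀ (x : T.Ob) (A : T.Generated), P A → P (of x ⊗ A)) (A : T.Generated) : P A :=
  List.rec (motive := P) one cons A

theorem homInd {P : ∀ {A B : T.Generated}, (A ⟶ B) → Prop} (gen : ∀ g : T.Gen, P (genHom g))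
    (id : ∀ A : T.Generated, P (𝟙 A))
    (comp : ∀ {A B C : T.Generated} (f : A ⟶ B) (g : B ⟶ C), P f → P g → P (f ≫ g))
    (tensor : ∀ {A B A' B' : T.Generated} (f : A ⟶ B) (g : A' ⟶ B'), P f → P g → P (f ⊗ₘ g))
    {A B : T.Generated} (f : A ⟶ B) : P f := by
  have of_term {A B : FreeMonoid T.Ob} (t : MonSignature.Term T.toMonSignature A B) :
      P (cls (Quotient.mk (MonSignature.Term.setoid A B) t)) := by
    induction t with
    | gen g => exact gen g
    | id A => exact id A
    | comp _ _ hf hg => exact comp _ _ hf hg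
    | tensor _ _ hf hg => exact tensor _ _ hf hg
  obtain ⟨⟨t⟩⟩ := f
  exact of_term t

section Past

variable (swap : ∀ x y : T.Ob, of x ⊗ of y ⟶ of y ⊗ of x) (x : T.Ob)

/-- The passage of a generating object past an arbitrary object, by successive swaps. -/
def past : ∀ A : T.Generated, of x ⊗ A ⟶ A ⊗ of x :=
  objRec ((ρ_ (of x)).hom ≫ (λ_ (of x)).inv) fun y A p =>
    (α_ (of x) (of y) A).inv ≫ swap x y ▷ A ≫ (α_ (of y) (of x) A).hom ≫ of y ◁ p ≫
      (α_ (of y) A (of x)).inv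

theorem past_unit : past swap x (𝟙_ T.Generated) = (ρ_ (of x)).hom ≫ (λ_ (of x)).inv := rfl

theorem past_of_tensor (y : T.Ob) (A : T.Generated) : past swap x (of y ⊗ A) =
    (α_ (of x) (of y) A).inv ≫ swap x y ▷ A ≫ (α_ (of y) (of x) A).hom ≫
      of y ◁ past swap x A ≫ (α_ (of y) A (of x)).inv := rfl

theorem past_eq_of_eq {A B : T.Generated} (h : A = B) :
    past swap x A = of x ◁ eqToHom h ≫ past swap x B ≫ eqToHom h.symm ▷ of x := by
  subst h
  simp

theorem past_of (y : T.Ob) : past swap x (of y) = swap x y := by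
  have h : past swap x (of y) =
      of x ◁ (ρ_ (of y)).inv ≫ past swap x (of y ⊗ 𝟙_ T.Generated) ≫ (ρ_ (of y)).hom ▷ of x :=
    past_eq_of_eq swap x (IsStrictMonoidal.tensor_unit (of y)).symm
  rw [h, past_of_tensor, past_unit]
  simp

theorem past_tensor (A B : T.Generated) : past swap x (A ⊗ B) =
    (α_ (of x) A B).inv ≫ past swap x A ▷ B ≫ (α_ A (of x) B).hom ≫ A ◁ past swap x B ≫
      (α_ A B (of x)).inv := by
  induction A using objRec with
  | one =>
    have h : past swap x (𝟙_ T.Generated ⊗ B) =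
        of x ◁ (λ_ B).hom ≫ past swap x B ≫ (λ_ B).inv ▷ of x :=
      past_eq_of_eq swap x (IsStrictMonoidal.unit_tensor B)
    rw [h, past_unit]
    monoidal
  | cons y A ih =>
    have h : past swap x ((of y ⊗ A) ⊗ B) =
        of x ◁ (α_ (of y) A B).hom ≫ past swap x (of y ⊗ (A ⊗ B)) ≫
          (α_ (of y) A B).inv ▷ of x :=
      past_eq_of_eq swap x (IsStrictMonoidal.tensor_assoc (of y) A B)
    rw [h, past_of_tensor, past_of_tensor, ih]
    monoidal

end Past

/-- Data for a symmetry on the category generated by a theory: involutive swaps of the generating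
objects, past which the generating morphisms slide. -/
structure SymmetricGenerators (T : MonTheory.{v, u, w}) where
  swap : ∀ x y : T.Ob, (of x ⊗ of y : T.Generated) ⟶ of y ⊗ of x
  swap_swap : ∀ x y, swap x y ≫ swap y x = 𝟙 (of x ⊗ of y)
  past_genHom : ∀ x g, of x ◁ genHom g ≫ past swap x (T.t g) = past swap x (T.s g) ≫ genHom g ▷ of x

namespace SymmetricGenerators

variable (S : T.SymmetricGenerators)

theorem whiskerLeft_past (x : T.Ob) {A B : T.Generated} (f : A ⟶ B) :
    of x ◁ f ≫ past S.swap x B = past S.swap x A ≫ f ▷ of x := by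
  induction f using homInd with
  | gen g => exact S.past_genHom x g
  | id A => simp
  | comp f g hf hg => simp [hg, reassoc_of% hf]
  | @tensor A B A' B' f g hf hg =>
    rw [past_tensor, past_tensor]
    calc of x ◁ (f ⊗ₘ g) ≫ (α_ (of x) B B').inv ≫ past S.swap x B ▷ B' ≫ (α_ B (of x) B').hom ≫
          B ◁ past S.swap x B' ≫ (α_ B B' (of x)).inv
        = (α_ (of x) A A').inv ≫ (of x ◁ f) ▷ A' ≫ ((of x ⊗ B) ◁ g ≫ past S.swap x B ▷ B') ≫
          (α_ B (of x) B').hom ≫ B ◁ past S.swap x B' ≫ (α_ B B' (of x)).inv := by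
          rw [MonoidalCategory.tensorHom_def]; monoidal
      _ = (α_ (of x) A A').inv ≫ (of x ◁ f ≫ past S.swap x B) ▷ A' ≫ (α_ B (of x) A').hom ≫
          B ◁ (of x ◁ g ≫ past S.swap x B') ≫ (α_ B B' (of x)).inv := by
          rw [whisker_exchange]; monoidal
      _ = (α_ (of x) A A').inv ≫ past S.swap x A ▷ A' ≫ (α_ A (of x) A').hom ≫
          (f ▷ (of x ⊗ A') ≫ B ◁ past S.swap x A') ≫ (α_ B A' (of x)).inv ≫ (B ◁ g) ▷ of x := by
          rw [hf, hg]; monoidal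
      _ = _ := by
          rw [← whisker_exchange, MonoidalCategory.tensorHom_def]; monoidal

/-- The symmetry of two objects of the generated category, moving the factors of the first object
one by one past the second. -/
def braid (A B : T.Generated) : A ⊗ B ⟶ B ⊗ A :=
  objRec (P := fun A => A ⊗ B ⟶ B ⊗ A) ((λ_ B).hom ≫ (ρ_ B).inv) (fun x A b =>
    (α_ (of x) A B).hom ≫ of x ◁ b ≫ (α_ (of x) B A).inv ≫ past S.swap x B ▷ A ≫
      (α_ B (of x) A).hom) A

theorem braid_unit (B : T.Generated) : S.braid (𝟙_ T.Generated) B = (λ_ B).hom ≫ (ρ_ B).inv := rfl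

theorem braid_of_tensor (x : T.Ob) (A B : T.Generated) : S.braid (of x ⊗ A) B =
    (α_ (of x) A B).hom ≫ of x ◁ S.braid A B ≫ (α_ (of x) B A).inv ≫ past S.swap x B ▷ A ≫
      (α_ B (of x) A).hom := rfl

theorem braid_eq_of_eq {A A' : T.Generated} (h : A = A') (B : T.Generated) :
    S.braid A B = eqToHom h ▷ B ≫ S.braid A' B ≫ B ◁ eqToHom h.symm := by
  subst h
  simp

theorem braid_of (x : T.Ob) (B : T.Generated) : S.braid (of x) B = past S.swap x B := by
  have h : S.braid (of x) B =
      (ρ_ (of x)).inv ▷ B ≫ S.braid (of x ⊗ 𝟙_ T.Generated) B ≫ B ◁ (ρ_ (of x)).hom :=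
    S.braid_eq_of_eq (IsStrictMonoidal.tensor_unit (of x)).symm B
  rw [h, braid_of_tensor, braid_unit]
  monoidal

theorem braid_tensor_left (A B C : T.Generated) : S.braid (A ⊗ B) C =
    (α_ A B C).hom ≫ A ◁ S.braid B C ≫ (α_ A C B).inv ≫ S.braid A C ▷ B ≫ (α_ C A B).hom := by
  induction A using objRec with
  | one =>
    have h : S.braid (𝟙_ T.Generated ⊗ B) C = (λ_ B).hom ▷ C ≫ S.braid B C ≫ C ◁ (λ_ B).inv :=
      S.braid_eq_of_eq (IsStrictMonoidal.unit_tensor B) C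
    rw [h, braid_unit]
    monoidal
  | cons x A ih =>
    have h : S.braid ((of x ⊗ A) ⊗ B) C =
        (α_ (of x) A B).hom ▷ C ≫ S.braid (of x ⊗ (A ⊗ B)) C ≫ C ◁ (α_ (of x) A B).inv :=
      S.braid_eq_of_eq (IsStrictMonoidal.tensor_assoc (of x) A B) C
    rw [h, braid_of_tensor, braid_of_tensor, ih]
    monoidal

theorem whiskerLeft_braid (A : T.Generated) {B C : T.Generated} (f : B ⟶ C) :
    A ◁ f ≫ S.braid A C = S.braid A B ≫ f ▷ A := by
  induction A using objRec with
  | one => simp [braid_unit]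
  | cons x A ih =>
    have h := congrArg (· ▷ A) (S.whiskerLeft_past x f)
    simp only [comp_whiskerRight] at h
    rw [braid_of_tensor, braid_of_tensor]
    simp only [tensor_whiskerLeft, Category.assoc, Iso.inv_hom_id_assoc]
    rw [← whiskerLeft_comp_assoc, ih]
    simp only [whiskerLeft_comp, Category.assoc, associator_inv_naturality_middle_assoc,
      whiskerRight_tensor, Iso.hom_inv_id_assoc, reassoc_of% h]

theorem past_braid_of (x : T.Ob) (A : T.Generated) :
    past S.swap x A ≫ S.braid A (of x) = 𝟙 (of x ⊗ A) := by
  induction A using objRec with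
  | one => simp [past_unit, braid_unit]
  | cons y A ih =>
    rw [past_of_tensor, braid_of_tensor, past_of]
    simp only [Category.assoc, Iso.inv_hom_id_assoc]
    rw [← whiskerLeft_comp_assoc (of y) (past S.swap x A), ih]
    simp [← comp_whiskerRight_assoc, S.swap_swap]

theorem braid_of_tensor_right (x : T.Ob) (A B : T.Generated) : S.braid A (of x ⊗ B) =
    (α_ A (of x) B).inv ≫ S.braid A (of x) ▷ B ≫ (α_ (of x) A B).hom ≫ of x ◁ S.braid A B ≫
      (α_ (of x) B A).inv := by
  induction A using objRec with
  | one => rw [braid_unit, braid_unit, braid_unit]; monoidal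
  | cons y A ih =>
    rw [braid_of_tensor, braid_of_tensor, braid_of_tensor, ih, past_of_tensor, past_of]
    calc _ = (α_ (of y) A (of x ⊗ B)).hom ≫
          of y ◁ ((α_ A (of x) B).inv ≫ S.braid A (of x) ▷ B ≫ (α_ (of x) A B).hom) ≫
          (α_ (of y) (of x) (A ⊗ B)).inv ≫
          ((of y ⊗ of x) ◁ S.braid A B ≫ S.swap y x ▷ (B ⊗ A)) ≫
          (α_ (of x) (of y) (B ⊗ A)).hom ≫
          of x ◁ ((α_ (of y) B A).inv ≫ past S.swap y B ▷ A ≫ (α_ B (of y) A).hom) ≫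
          (α_ (of x) B (of y ⊗ A)).inv := by monoidal
      _ = _ := by rw [whisker_exchange]; monoidal

theorem braid_unit_right (A : T.Generated) :
    S.braid A (𝟙_ T.Generated) = (ρ_ A).hom ≫ (λ_ A).inv := by
  induction A using objRec with
  | one => rw [braid_unit, unitors_equal, unitors_inv_equal]
  | cons x A ih =>
    rw [braid_of_tensor, ih, past_unit]
    monoidal

theorem braid_braid (A B : T.Generated) : S.braid A B ≫ S.braid B A = 𝟙 (A ⊗ B) := by
  induction A using objRec with
  | one => simp [braid_unit, braid_unit_right]
  | cons x A ih =>
    rw [braid_of_tensor, braid_of_tensor_right]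
    simp only [Category.assoc, Iso.hom_inv_id_assoc]
    rw [← comp_whiskerRight_assoc, past_braid_of]
    simp only [id_whiskerRight, Category.id_comp, Iso.inv_hom_id_assoc]
    rw [← whiskerLeft_comp_assoc, ih]
    simp

/-- The symmetry as an isomorphism. -/
@[simps]
def braidIso (A B : T.Generated) : A ⊗ B ≅ B ⊗ A where
  hom := S.braid A B
  inv := S.braid B A
  hom_inv_id := S.braid_braid A B
  inv_hom_id := S.braid_braid B A

theorem braid_tensor_right (A B C : T.Generated) : S.braid A (B ⊗ C) =
    (α_ A B C).inv ≫ S.braid A B ▷ C ≫ (α_ B A C).hom ≫ B ◁ S.braid A C ≫ (α_ B C A).inv := by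
  have h : S.braidIso (B ⊗ C) A = α_ B C A ≪≫ whiskerLeftIso B (S.braidIso C A) ≪≫
      (α_ B A C).symm ≪≫ whiskerRightIso (S.braidIso B A) C ≪≫ α_ A B C := by
    ext
    simp [braid_tensor_left]
  simpa using congrArg Iso.inv h

/-- The symmetric structure of a generated category determined by a symmetry on its generators. -/
abbrev symmetricCategory : SymmetricCategory T.Generated where
  braiding := S.braidIso
  braiding_naturality_right A _ _ f := S.whiskerLeft_braid A f
  braiding_naturality_left {A B} f C := by
    rw [← cancel_mono (S.braidIso C B).hom, ← cancel_epi (S.braidIso C A).hom]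
    simp [braid_braid, reassoc_of% (S.braid_braid C A), whiskerLeft_braid]
  hexagon_forward A B C := by simp [braid_tensor_right]
  hexagon_reverse A B C := by simp [braid_tensor_left]
  symmetry A B := S.braid_braid A B

end SymmetricGenerators

end MonTheory

section Braided

variable {C : Type u} [Category.{v} C] [MonoidalCategory C]

theorem tensorHom_toUnit_assoc {A B D : C} (a : A ⟶ 𝟙_ C) (b : B ⟶ 𝟙_ C) (d : D ⟶ 𝟙_ C) :
    (α_ A B D).hom ≫ (a ⊗ₘ (b ⊗ₘ d) ≫ (λ_ (𝟙_ C)).hom) ≫ (λ_ (𝟙_ C)).hom =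
      ((a ⊗ₘ b) ≫ (λ_ (𝟙_ C)).hom ⊗ₘ d) ≫ (λ_ (𝟙_ C)).hom := by
  monoidal

theorem tensorμ_comp_tensorHom_braiding [SymmetricCategory C] (A B : C) :
    tensorμ A A B B ≫ ((β_ A B).hom ⊗ₘ (β_ A B).hom) =
      (β_ (A ⊗ A) (B ⊗ B)).hom ≫ tensorμ B B A A := by
  dsimp only [tensorμ]
  symm
  calc
    _ = 𝟙 _ ⊗≫ A ◁ (β_ A B).hom ▷ B ⊗≫ (A ⊗ B) ◁ (β_ A B).hom ⊗≫ (β_ A B).hom ▷ (B ⊗ A) ⊗≫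
        B ◁ ((β_ A B).hom ≫ (β_ B A).hom) ▷ A ⊗≫ 𝟙 _ := by
      rw [BraidedCategory.braiding_tensor_left_hom, BraidedCategory.braiding_tensor_right_hom]
      monoidal
    _ = _ := by
      rw [SymmetricCategory.symmetry, MonoidalCategory.tensorHom_def']
      monoidal

variable [BraidedCategory C] {A B : C}

theorem tensorμ_comp_delete_tensorHom (a : A ⟶ 𝟙_ C) (b : B ⟶ 𝟙_ C) :
    tensorμ A A B B ≫ ((A ◁ b ≫ (ρ_ A).hom) ⊗ₘ (a ▷ B ≫ (λ_ B).hom)) =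
      (A ◁ a ≫ (ρ_ A).hom) ⊗ₘ (b ▷ B ≫ (λ_ B).hom) := by
  have natural := tensorμ_natural (𝟙 A) a b (𝟙 B)
  have tensorμ_unit : tensorμ A (𝟙_ C) (𝟙_ C) B = 𝟙 _ := by
    rw [tensorμ, braiding_tensorUnit_left, ← unitors_inv_equal]
    simp
  rw [tensorμ_unit, Category.comp_id] at natural
  simp only [id_tensorHom, tensorHom_id] at natural
  rw [← tensorHom_comp_tensorHom, ← reassoc_of% natural, tensorHom_comp_tensorHom]

theorem tensorμ_comp_whiskerLeft_delete (a : A ⟶ 𝟙_ C) (b : B ⟶ 𝟙_ C) :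
    tensorμ A A B B ≫ (A ⊗ B) ◁ ((a ⊗ₘ b) ≫ (λ_ (𝟙_ C)).hom) ≫ (ρ_ (A ⊗ B)).hom =
      (A ◁ a ≫ (ρ_ A).hom) ⊗ₘ (B ◁ b ≫ (ρ_ B).hom) := by
  have natural := tensorμ_natural (𝟙 A) a (𝟙 B) b
  simp only [id_tensorHom, whiskerLeft_id] at natural
  rw [whiskerLeft_comp, Category.assoc, ← reassoc_of% natural, ← rightUnitor_monoidal,
    tensorHom_comp_tensorHom]

theorem tensorμ_comp_delete_whiskerRight (a : A ⟶ 𝟙_ C) (b : B ⟶ 𝟙_ C) :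
    tensorμ A A B B ≫ ((a ⊗ₘ b) ≫ (λ_ (𝟙_ C)).hom) ▷ (A ⊗ B) ≫ (λ_ (A ⊗ B)).hom =
      (a ▷ A ≫ (λ_ A).hom) ⊗ₘ (b ▷ B ≫ (λ_ B).hom) := by
  have natural := tensorμ_natural a (𝟙 A) b (𝟙 B)
  simp only [tensorHom_id, id_whiskerRight] at natural
  rw [comp_whiskerRight, Category.assoc, ← reassoc_of% natural, ← leftUnitor_monoidal,
    tensorHom_comp_tensorHom]

end Braided

/-- Uniform copying and deleting, in the sense of Heunen and Vicary: natural families of copying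
and deleting morphisms, compatible with the tensor product, with deleting a counit for copying. -/
structure UniformCopyDelete (C : Type u) [Category.{v} C] [MonoidalCategory C]
    [BraidedCategory C] where
  copy : ∀ A : C, A ⟶ A ⊗ A
  delete : ∀ A : C, A ⟶ 𝟙_ C
  comp_copy : ∀ {A B : C} (f : A ⟶ B), f ≫ copy B = copy A ≫ (f ⊗ₘ f)
  comp_delete : ∀ {A B : C} (f : A ⟶ B), f ≫ delete B = delete A
  copy_delete_right : ∀ A, copy A ≫ A ◁ delete A ≫ (ρ_ A).hom = 𝟙 A
  copy_delete_left : ∀ A, copy A ≫ delete A ▷ A ≫ (λ_ A).hom = 𝟙 A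
  copy_tensor : ∀ A B, copy (A ⊗ B) = (copy A ⊗ₘ copy B) ≫ tensorμ A A B B
  delete_unit : delete (𝟙_ C) = 𝟙 (𝟙_ C)

namespace UniformCopyDelete

variable {C : Type u} [Category.{v} C] [MonoidalCategory C] [BraidedCategory C]
  (K : UniformCopyDelete C)

/-- The first projection of a tensor product, deleting the second factor. -/
def fst (A B : C) : A ⊗ B ⟶ A :=
  A ◁ K.delete B ≫ (ρ_ A).hom

/-- The second projection of a tensor product, deleting the first factor. -/
def snd (A B : C) : A ⊗ B ⟶ B :=
  K.delete A ▷ B ≫ (λ_ B).hom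

/-- The pairing of two morphisms, copying the source. -/
def pair {A B D : C} (f : A ⟶ B) (g : A ⟶ D) : A ⟶ B ⊗ D :=
  K.copy A ≫ (f ⊗ₘ g)

theorem tensorHom_fst {A B A' B' : C} (f : A ⟶ B) (g : A' ⟶ B') :
    (f ⊗ₘ g) ≫ K.fst B B' = K.fst A A' ≫ f := by
  rw [fst, fst, ← id_tensorHom, tensorHom_comp_tensorHom_assoc, comp_delete, Category.comp_id,
    Category.assoc, ← rightUnitor_naturality, MonoidalCategory.tensorHom_def', Category.assoc]

theorem tensorHom_snd {A B A' B' : C} (f : A ⟶ B) (g : A' ⟶ B') :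
    (f ⊗ₘ g) ≫ K.snd B B' = K.snd A A' ≫ g := by
  rw [snd, snd, ← tensorHom_id, tensorHom_comp_tensorHom_assoc, comp_delete, Category.comp_id,
    Category.assoc, ← leftUnitor_naturality, MonoidalCategory.tensorHom_def, Category.assoc]

theorem pair_fst {A B D : C} (f : A ⟶ B) (g : A ⟶ D) : K.pair f g ≫ K.fst B D = f := by
  rw [pair, Category.assoc, tensorHom_fst, fst, Category.assoc, reassoc_of% K.copy_delete_right]

theorem pair_snd {A B D : C} (f : A ⟶ B) (g : A ⟶ D) : K.pair f g ≫ K.snd B D = g := by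
  rw [pair, Category.assoc, tensorHom_snd, snd, Category.assoc, reassoc_of% K.copy_delete_left]

theorem pair_fst_snd (A B : C) : K.pair (K.fst A B) (K.snd A B) = 𝟙 (A ⊗ B) := by
  rw [pair, copy_tensor, Category.assoc, fst, snd, tensorμ_comp_delete_tensorHom,
    tensorHom_comp_tensorHom, copy_delete_right, copy_delete_left, id_tensorHom_id]

theorem comp_pair {A A' B D : C} (h : A' ⟶ A) (f : A ⟶ B) (g : A ⟶ D) :
    h ≫ K.pair f g = K.pair (h ≫ f) (h ≫ g) := by
  rw [pair, pair, reassoc_of% K.comp_copy, tensorHom_comp_tensorHom]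

/-- A braided category with uniform copying and deleting is cartesian. -/
abbrev cartesianMonoidalCategory : CartesianMonoidalCategory C where
  isTerminalTensorUnit := Limits.IsTerminal.ofUniqueHom K.delete fun A f => by
    rw [← K.comp_delete f, K.delete_unit, Category.comp_id]
  fst := K.fst
  snd := K.snd
  fst_def _ _ := rfl
  snd_def _ _ := rfl
  tensorProductIsBinaryProduct A B :=
    Limits.BinaryFan.isLimitMk (fun s => K.pair s.fst s.snd)
      (fun s => K.pair_fst s.fst s.snd) (fun s => K.pair_snd s.fst s.snd)
      (fun s m h₁ h₂ => by
        rw [← h₁, ← h₂, ← comp_pair, pair_fst_snd, Category.comp_id])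

end UniformCopyDelete

namespace MonTheory

variable {T : MonTheory.{v, u, w}}

section ExtendDelete

variable (d : ∀ x : T.Ob, of x ⟶ 𝟙_ T.Generated)

/-- The deletion of an arbitrary object, deleting each of its factors. -/
def extendDelete : ∀ A : T.Generated, A ⟶ 𝟙_ T.Generated :=
  objRec (𝟙 _) fun x _ e => (d x ⊗ₘ e) ≫ (λ_ _).hom

theorem extendDelete_unit : extendDelete d (𝟙_ T.Generated) = 𝟙 _ := rfl

theorem extendDelete_of_tensor (x : T.Ob) (A : T.Generated) :
    extendDelete d (of x ⊗ A) = (d x ⊗ₘ extendDelete d A) ≫ (λ_ _).hom := rfl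

theorem extendDelete_eq_of_eq {A B : T.Generated} (h : A = B) :
    extendDelete d A = eqToHom h ≫ extendDelete d B := by
  subst h
  simp

theorem extendDelete_of (x : T.Ob) : extendDelete d (of x) = d x := by
  have h : extendDelete d (of x) = (ρ_ (of x)).inv ≫ extendDelete d (of x ⊗ 𝟙_ T.Generated) :=
    extendDelete_eq_of_eq d (IsStrictMonoidal.tensor_unit (of x)).symm
  rw [h, extendDelete_of_tensor, extendDelete_unit]
  simp [unitors_equal]

theorem extendDelete_tensor (A B : T.Generated) :
    extendDelete d (A ⊗ B) = (extendDelete d A ⊗ₘ extendDelete d B) ≫ (λ_ _).hom := by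
  induction A using objRec with
  | one =>
    have h : extendDelete d (𝟙_ T.Generated ⊗ B) = (λ_ B).hom ≫ extendDelete d B :=
      extendDelete_eq_of_eq d (IsStrictMonoidal.unit_tensor B)
    rw [h, extendDelete_unit]
    simp
  | cons x A ih =>
    have h : extendDelete d ((of x ⊗ A) ⊗ B) =
        (α_ (of x) A B).hom ≫ extendDelete d (of x ⊗ (A ⊗ B)) :=
      extendDelete_eq_of_eq d (IsStrictMonoidal.tensor_assoc (of x) A B)
    rw [h, extendDelete_of_tensor, extendDelete_of_tensor, ih, tensorHom_toUnit_assoc]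

end ExtendDelete

variable [BraidedCategory T.Generated]

section ExtendCopy

variable (c : ∀ x : T.Ob, of x ⟶ of x ⊗ of x)

/-- The copying of an arbitrary object, copying each of its factors. -/
def extendCopy : ∀ A : T.Generated, A ⟶ A ⊗ A :=
  objRec (λ_ _).inv fun x A e => (c x ⊗ₘ e) ≫ tensorμ (of x) (of x) A A

theorem extendCopy_unit : extendCopy c (𝟙_ T.Generated) = (λ_ _).inv := rfl

theorem extendCopy_of_tensor (x : T.Ob) (A : T.Generated) :
    extendCopy c (of x ⊗ A) = (c x ⊗ₘ extendCopy c A) ≫ tensorμ (of x) (of x) A A := rfl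

theorem extendCopy_eq_of_eq {A B : T.Generated} (h : A = B) :
    extendCopy c A = eqToHom h ≫ extendCopy c B ≫ (eqToHom h.symm ⊗ₘ eqToHom h.symm) := by
  subst h
  simp

theorem extendCopy_of (x : T.Ob) : extendCopy c (of x) = c x := by
  have h : extendCopy c (of x) = (ρ_ (of x)).inv ≫ extendCopy c (of x ⊗ 𝟙_ T.Generated) ≫
      ((ρ_ (of x)).hom ⊗ₘ (ρ_ (of x)).hom) :=
    extendCopy_eq_of_eq c (IsStrictMonoidal.tensor_unit (of x)).symm
  rw [h, extendCopy_of_tensor, extendCopy_unit, MonoidalCategory.tensorHom_def]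
  simp only [Category.assoc]
  rw [← tensor_right_unitality]
  simp

theorem extendCopy_tensor (A B : T.Generated) :
    extendCopy c (A ⊗ B) = (extendCopy c A ⊗ₘ extendCopy c B) ≫ tensorμ A A B B := by
  induction A using objRec with
  | one =>
    have h : extendCopy c (𝟙_ T.Generated ⊗ B) =
        (λ_ B).hom ≫ extendCopy c B ≫ ((λ_ B).inv ⊗ₘ (λ_ B).inv) :=
      extendCopy_eq_of_eq c (IsStrictMonoidal.unit_tensor B)
    rw [h, extendCopy_unit, MonoidalCategory.tensorHom_def' _ (extendCopy c B), Category.assoc,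
      ← leftUnitor_naturality_assoc, tensor_left_unitality]
    simp
  | cons x A ih =>
    have h : extendCopy c ((of x ⊗ A) ⊗ B) = (α_ (of x) A B).hom ≫
        extendCopy c (of x ⊗ (A ⊗ B)) ≫ ((α_ (of x) A B).inv ⊗ₘ (α_ (of x) A B).inv) :=
      extendCopy_eq_of_eq c (IsStrictMonoidal.tensor_assoc (of x) A B)
    have tensorμ_left : ((c x ⊗ₘ extendCopy c A) ≫ tensorμ (of x) (of x) A A ⊗ₘ extendCopy c B) =
        ((c x ⊗ₘ extendCopy c A) ⊗ₘ extendCopy c B) ≫ tensorμ (of x) (of x) A A ▷ _ := by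
      rw [← tensorHom_id, tensorHom_comp_tensorHom, Category.comp_id]
    rw [h, extendCopy_of_tensor, extendCopy_of_tensor, ih,
      ← cancel_mono ((α_ (of x) A B).hom ⊗ₘ (α_ (of x) A B).hom), tensorμ_left]
    simp only [Category.assoc]
    rw [tensor_associativity, associator_naturality_assoc, ← id_tensorHom,
      tensorHom_comp_tensorHom_assoc, Category.comp_id, tensorHom_comp_tensorHom]
    simp

end ExtendCopy

/-- Data for uniform copying and deleting on the category generated by a theory: copying and
deleting of the generating objects, with respect to which the generating morphisms are natural. -/
structure CopyDeleteGenerators (T : MonTheory.{v, u, w}) [BraidedCategory T.Generated] where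
  copy : ∀ x : T.Ob, (of x : T.Generated) ⟶ of x ⊗ of x
  delete : ∀ x : T.Ob, (of x : T.Generated) ⟶ 𝟙_ T.Generated
  copy_delete_right : ∀ x, copy x ≫ of x ◁ delete x ≫ (ρ_ (of x)).hom = 𝟙 (of x)
  copy_delete_left : ∀ x, copy x ≫ delete x ▷ of x ≫ (λ_ (of x)).hom = 𝟙 (of x)
  genHom_copy : ∀ g, genHom g ≫ extendCopy copy (T.t g) =
    extendCopy copy (T.s g) ≫ (genHom g ⊗ₘ genHom g)
  genHom_delete : ∀ g, genHom g ≫ extendDelete delete (T.t g) = extendDelete delete (T.s g)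

namespace CopyDeleteGenerators

variable (K : T.CopyDeleteGenerators)

theorem comp_extendDelete {A B : T.Generated} (f : A ⟶ B) :
    f ≫ extendDelete K.delete B = extendDelete K.delete A := by
  induction f using homInd with
  | gen g => exact K.genHom_delete g
  | id A => simp
  | comp f g hf hg => simp [hf, hg]
  | tensor f g hf hg => simp [extendDelete_tensor, hf, hg]

theorem comp_extendCopy {A B : T.Generated} (f : A ⟶ B) :
    f ≫ extendCopy K.copy B = extendCopy K.copy A ≫ (f ⊗ₘ f) := by
  induction f using homInd with
  | gen g => exact K.genHom_copy g
  | id A => simp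
  | comp f g hf hg => simp [hg, reassoc_of% hf]
  | tensor f g hf hg =>
    rw [extendCopy_tensor, extendCopy_tensor, Category.assoc, ← tensorμ_natural,
      tensorHom_comp_tensorHom_assoc, tensorHom_comp_tensorHom_assoc, hf, hg]

theorem extendCopy_delete_right (A : T.Generated) :
    extendCopy K.copy A ≫ A ◁ extendDelete K.delete A ≫ (ρ_ A).hom = 𝟙 A := by
  induction A using objRec with
  | one => simp [extendCopy_unit, extendDelete_unit, ← unitors_equal]
  | cons x A ih =>
    rw [extendCopy_of_tensor, extendDelete_of_tensor, Category.assoc,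
      tensorμ_comp_whiskerLeft_delete, tensorHom_comp_tensorHom, ih, K.copy_delete_right,
      id_tensorHom_id]

theorem extendCopy_delete_left (A : T.Generated) :
    extendCopy K.copy A ≫ extendDelete K.delete A ▷ A ≫ (λ_ A).hom = 𝟙 A := by
  induction A using objRec with
  | one => simp [extendCopy_unit, extendDelete_unit]
  | cons x A ih =>
    rw [extendCopy_of_tensor, extendDelete_of_tensor, Category.assoc,
      tensorμ_comp_delete_whiskerRight, tensorHom_comp_tensorHom, ih, K.copy_delete_left,
      id_tensorHom_id]

/-- The uniform copying and deleting determined by copying and deleting of the generators. -/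
def uniformCopyDelete : UniformCopyDelete T.Generated where
  copy := extendCopy K.copy
  delete := extendDelete K.delete
  comp_copy := K.comp_extendCopy
  comp_delete := K.comp_extendDelete
  copy_delete_right := K.extendCopy_delete_right
  copy_delete_left := K.extendCopy_delete_left
  copy_tensor := extendCopy_tensor K.copy
  delete_unit := extendDelete_unit K.delete

end CopyDeleteGenerators

end MonTheory

namespace Bialg

/-- The monoidal category generated by the theory of qualitative bicommutative bialgebras. -/
abbrev QBialg : Type := qualitativeTheory.Generated

namespace QBialg

open MonTheory

/-- The generating object of `QBialg`. -/
abbrev pt : QBialg := of (T := qualitativeTheory) ()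

/-- The multiplication of the generating object. -/
def mul : pt ⊗ pt ⟶ pt := genHom (T := qualitativeTheory) .mu

/-- The unit of the generating object. -/
def unit : 𝟙_ QBialg ⟶ pt := genHom (T := qualitativeTheory) .eta

/-- The comultiplication of the generating object. -/
def comul : pt ⟶ pt ⊗ pt := genHom (T := qualitativeTheory) .delta

/-- The counit of the generating object. -/
def counit : pt ⟶ 𝟙_ QBialg := genHom (T := qualitativeTheory) .eps

/-- The swap of two copies of the generating object. -/
def swap : pt ⊗ pt ⟶ pt ⊗ pt := genHom (T := qualitativeTheory) .gamma

section Relations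

theorem comul_mul : comul ≫ mul = 𝟙 pt :=
  cls_rel (T := qualitativeTheory) none

theorem swap_swap : swap ≫ swap = 𝟙 (pt ⊗ pt) :=
  cls_rel (T := qualitativeTheory) (some .symSym)

theorem yangBaxter :
    swap ▷ pt ≫ (α_ pt pt pt).hom ≫ pt ◁ swap ≫ (α_ pt pt pt).inv ≫ swap ▷ pt =
      (α_ pt pt pt).hom ≫ pt ◁ swap ≫ (α_ pt pt pt).inv ≫ swap ▷ pt ≫ (α_ pt pt pt).hom ≫
        pt ◁ swap ≫ (α_ pt pt pt).inv :=
  cls_rel (T := qualitativeTheory) (some .yangBaxter)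

theorem mul_assoc : mul ▷ pt ≫ mul = (α_ pt pt pt).hom ≫ pt ◁ mul ≫ mul :=
  cls_rel (T := qualitativeTheory) (some .mulAssoc)

theorem unit_mul : (λ_ pt).inv ≫ unit ▷ pt ≫ mul = 𝟙 pt :=
  cls_rel (T := qualitativeTheory) (some .unitMul)

theorem mul_unit : (ρ_ pt).inv ≫ pt ◁ unit ≫ mul = 𝟙 pt :=
  cls_rel (T := qualitativeTheory) (some .mulUnit)

theorem mul_swap : pt ◁ mul ≫ swap = (α_ pt pt pt).inv ≫ swap ▷ pt ≫ (α_ pt pt pt).hom ≫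
    pt ◁ swap ≫ (α_ pt pt pt).inv ≫ mul ▷ pt :=
  cls_rel (T := qualitativeTheory) (some .mulSymRight)

theorem unit_swap : (ρ_ pt).inv ≫ pt ◁ unit ≫ swap = (λ_ pt).inv ≫ unit ▷ pt :=
  cls_rel (T := qualitativeTheory) (some .unitSymRight)

theorem swap_mul : swap ≫ mul = mul :=
  cls_rel (T := qualitativeTheory) (some .mulComm)

theorem comul_coassoc : comul ≫ comul ▷ pt = comul ≫ pt ◁ comul ≫ (α_ pt pt pt).inv :=
  cls_rel (T := qualitativeTheory) (some .comulCoassoc)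

theorem counit_comul : comul ≫ counit ▷ pt ≫ (λ_ pt).hom = 𝟙 pt :=
  cls_rel (T := qualitativeTheory) (some .counitComul)

theorem comul_counit : comul ≫ pt ◁ counit ≫ (ρ_ pt).hom = 𝟙 pt :=
  cls_rel (T := qualitativeTheory) (some .comulCounit)

theorem swap_comul : swap ≫ comul ▷ pt = pt ◁ comul ≫ (α_ pt pt pt).inv ≫ swap ▷ pt ≫
    (α_ pt pt pt).hom ≫ pt ◁ swap ≫ (α_ pt pt pt).inv :=
  cls_rel (T := qualitativeTheory) (some .comulSymLeft)

theorem swap_counit : swap ≫ counit ▷ pt ≫ (λ_ pt).hom = pt ◁ counit ≫ (ρ_ pt).hom :=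
  cls_rel (T := qualitativeTheory) (some .counitSymLeft)

theorem comul_swap : comul ≫ swap = comul :=
  cls_rel (T := qualitativeTheory) (some .comulCocomm)

theorem mul_comul : mul ≫ comul = (comul ⊗ₘ comul) ≫ (α_ pt pt (pt ⊗ pt)).hom ≫
    pt ◁ (α_ pt pt pt).inv ≫ pt ◁ (swap ▷ pt) ≫ pt ◁ (α_ pt pt pt).hom ≫
      (α_ pt pt (pt ⊗ pt)).inv ≫ (mul ⊗ₘ mul) :=
  cls_rel (T := qualitativeTheory) (some .mulComul)

theorem mul_counit : mul ≫ counit = (counit ⊗ₘ counit) ≫ (λ_ (𝟙_ QBialg)).hom :=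
  cls_rel (T := qualitativeTheory) (some .mulCounit)

theorem unit_comul : unit ≫ comul = (λ_ (𝟙_ QBialg)).inv ≫ (unit ⊗ₘ unit) :=
  cls_rel (T := qualitativeTheory) (some .unitComul)

theorem unit_counit : unit ≫ counit = 𝟙 (𝟙_ QBialg) :=
  cls_rel (T := qualitativeTheory) (some .unitCounit)

end Relations

section Symmetry

/-- The passage of the generating object past an arbitrary object. -/
abbrev pastPt : ∀ A : QBialg, pt ⊗ A ⟶ A ⊗ pt :=
  past (T := qualitativeTheory) (fun _ _ => swap) ()

theorem pastPt_unit : pastPt (𝟙_ QBialg) = (ρ_ pt).hom ≫ (λ_ pt).inv := past_unit _ _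

theorem pastPt_pt : pastPt pt = swap := past_of _ _ _

theorem pastPt_tensor (A B : QBialg) : pastPt (A ⊗ B) =
    (α_ pt A B).inv ≫ pastPt A ▷ B ≫ (α_ A pt B).hom ≫ A ◁ pastPt B ≫ (α_ A B pt).inv :=
  past_tensor _ _ _ _

theorem whiskerLeft_mul_past : pt ◁ mul ≫ pastPt pt = pastPt (pt ⊗ pt) ≫ mul ▷ pt := by
  rw [pastPt_tensor, pastPt_pt, mul_swap]
  simp only [Category.assoc]

theorem whiskerLeft_unit_past : pt ◁ unit ≫ pastPt pt = pastPt (𝟙_ QBialg) ≫ unit ▷ pt := by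
  rw [pastPt_pt, pastPt_unit, ← cancel_epi (ρ_ pt).inv, unit_swap]
  simp

theorem whiskerLeft_comul_past : pt ◁ comul ≫ pastPt (pt ⊗ pt) = pastPt pt ≫ comul ▷ pt := by
  rw [pastPt_tensor, pastPt_pt, swap_comul]

theorem whiskerLeft_counit_past : pt ◁ counit ≫ pastPt (𝟙_ QBialg) = pastPt pt ≫ counit ▷ pt := by
  rw [pastPt_pt, pastPt_unit, ← cancel_mono (λ_ pt).hom]
  simp [swap_counit]

theorem whiskerLeft_swap_past :
    pt ◁ swap ≫ pastPt (pt ⊗ pt) = pastPt (pt ⊗ pt) ≫ swap ▷ pt := by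
  have braid := yangBaxter
  simp only [pastPt_tensor, pastPt_pt, Category.assoc, ← cancel_epi (α_ pt pt pt).hom]
  simp [braid]

/-- The swap of two copies of the generating object, as the data of a symmetry. -/
def symmetricGenerators : qualitativeTheory.SymmetricGenerators where
  swap _ _ := swap
  swap_swap _ _ := swap_swap
  past_genHom _ g :=
    match g with
    | .mu => whiskerLeft_mul_past
    | .eta => whiskerLeft_unit_past
    | .delta => whiskerLeft_comul_past
    | .eps => whiskerLeft_counit_past
    | .gamma => whiskerLeft_swap_past

instance : SymmetricCategory QBialg := symmetricGenerators.symmetricCategory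

theorem braiding_pt_pt : (β_ pt pt).hom = swap :=
  (symmetricGenerators.braid_of () pt).trans pastPt_pt

end Symmetry

section Cartesian

/-- The deletion of an arbitrary object by means of the counit. -/
abbrev delete : ∀ A : QBialg, A ⟶ 𝟙_ QBialg :=
  extendDelete (T := qualitativeTheory) fun _ => counit

/-- The copying of an arbitrary object by means of the comultiplication. -/
abbrev copy : ∀ A : QBialg, A ⟶ A ⊗ A :=
  extendCopy (T := qualitativeTheory) fun _ => comul

theorem delete_unit : delete (𝟙_ QBialg) = 𝟙 _ := extendDelete_unit _

theorem delete_pt : delete pt = counit := extendDelete_of _ _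

theorem delete_tensor (A B : QBialg) :
    delete (A ⊗ B) = (delete A ⊗ₘ delete B) ≫ (λ_ _).hom :=
  extendDelete_tensor _ _ _

theorem copy_unit : copy (𝟙_ QBialg) = (λ_ _).inv := extendCopy_unit _

theorem copy_pt : copy pt = comul := extendCopy_of _ _

theorem copy_tensor (A B : QBialg) : copy (A ⊗ B) = (copy A ⊗ₘ copy B) ≫ tensorμ A A B B :=
  extendCopy_tensor _ _ _

theorem comul_comp_counit_tensorHom_counit :
    comul ≫ (counit ⊗ₘ counit) ≫ (λ_ (𝟙_ QBialg)).hom = counit := by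
  simpa [unitors_equal, MonoidalCategory.tensorHom_def'] using comul_counit =≫ counit

theorem swap_comp_counit_tensorHom_counit :
    swap ≫ (counit ⊗ₘ counit) ≫ (λ_ (𝟙_ QBialg)).hom =
      (counit ⊗ₘ counit) ≫ (λ_ (𝟙_ QBialg)).hom := by
  rw [← braiding_pt_pt, ← BraidedCategory.braiding_naturality_assoc, braiding_leftUnitor,
    unitors_equal]

theorem comul_tensorHom_comul_eq : comul ≫ (comul ⊗ₘ comul) =
    comul ≫ pt ◁ (comul ≫ comul ▷ pt ≫ (α_ pt pt pt).hom) ≫ (α_ pt pt (pt ⊗ pt)).inv := by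
  have coassoc := congrArg (fun k => comul ≫ pt ◁ k) (comul_coassoc =≫ (α_ pt pt pt).hom)
  simp only [Category.assoc, Iso.inv_hom_id, Category.comp_id, whiskerLeft_comp] at coassoc
  rw [MonoidalCategory.tensorHom_def, reassoc_of% comul_coassoc]
  simp [reassoc_of% coassoc]

-- The four outputs are regrouped so that `tensorμ` swaps the two produced by a single `comul`.
theorem comul_tensorHom_comul_tensorμ :
    comul ≫ (comul ⊗ₘ comul) ≫ tensorμ pt pt pt pt = comul ≫ (comul ⊗ₘ comul) := by
  rw [← Category.assoc, comul_tensorHom_comul_eq, tensorμ, braiding_pt_pt]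
  simp only [Category.assoc, Iso.inv_hom_id_assoc, ← whiskerLeft_comp_assoc, Iso.hom_inv_id_assoc]
  rw [← comp_whiskerRight_assoc, comul_swap]

theorem mul_copy : mul ≫ copy pt = copy (pt ⊗ pt) ≫ (mul ⊗ₘ mul) := by
  rw [copy_tensor, copy_pt, mul_comul, tensorμ, braiding_pt_pt]
  simp only [Category.assoc]

theorem unit_copy : unit ≫ copy pt = copy (𝟙_ QBialg) ≫ (unit ⊗ₘ unit) := by
  rw [copy_pt, copy_unit, unit_comul]

theorem comul_copy : comul ≫ copy (pt ⊗ pt) = copy pt ≫ (comul ⊗ₘ comul) := by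
  rw [copy_tensor, copy_pt, comul_tensorHom_comul_tensorμ]

theorem counit_copy : counit ≫ copy (𝟙_ QBialg) = copy pt ≫ (counit ⊗ₘ counit) := by
  rw [copy_pt, copy_unit, ← cancel_mono (λ_ (𝟙_ QBialg)).hom, Category.assoc, Category.assoc,
    Iso.inv_hom_id, Category.comp_id, comul_comp_counit_tensorHom_counit]

theorem swap_copy : swap ≫ copy (pt ⊗ pt) = copy (pt ⊗ pt) ≫ (swap ⊗ₘ swap) := by
  rw [copy_tensor, copy_pt, ← braiding_pt_pt, Category.assoc, tensorμ_comp_tensorHom_braiding,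
    BraidedCategory.braiding_naturality_assoc]

theorem mul_delete : mul ≫ delete pt = delete (pt ⊗ pt) := by
  rw [delete_tensor, delete_pt, mul_counit]

theorem unit_delete : unit ≫ delete pt = delete (𝟙_ QBialg) := by
  rw [delete_pt, delete_unit, unit_counit]

theorem comul_delete : comul ≫ delete (pt ⊗ pt) = delete pt := by
  rw [delete_tensor, delete_pt, comul_comp_counit_tensorHom_counit]

theorem counit_delete : counit ≫ delete (𝟙_ QBialg) = delete pt := by
  rw [delete_pt, delete_unit, Category.comp_id]

theorem swap_delete : swap ≫ delete (pt ⊗ pt) = delete (pt ⊗ pt) := by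
  rw [delete_tensor, delete_pt, swap_comp_counit_tensorHom_counit]

/-- The comultiplication and the counit of the generating object, as the data of uniform copying
and deleting. -/
def copyDeleteGenerators : qualitativeTheory.CopyDeleteGenerators where
  copy _ := comul
  delete _ := counit
  copy_delete_right _ := comul_counit
  copy_delete_left _ := counit_comul
  genHom_copy g :=
    match g with
    | .mu => mul_copy
    | .eta => unit_copy
    | .delta => comul_copy
    | .eps => counit_copy
    | .gamma => swap_copy
  genHom_delete g :=
    match g with
    | .mu => mul_delete
    | .eta => unit_delete
    | .delta => comul_delete
    | .eps => counit_delete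
    | .gamma => swap_delete

instance : CartesianMonoidalCategory QBialg :=
  copyDeleteGenerators.uniformCopyDelete.cartesianMonoidalCategory

end Cartesian

end QBialg

end Bialg

section IdempotentProd

variable {ι M : Type*} [DecidableEq ι] [CommMonoid M] {a : ι → M}

theorem prod_insert_of_mul_self (h : ∀ i, a i * a i = a i) (i : ι) (s : Finset ι) :
    ∏ j ∈ insert i s, a j = a i * ∏ j ∈ s, a j := by
  by_cases hi : i ∈ s
  · rw [Finset.insert_eq_of_mem hi, ← Finset.mul_prod_erase s a hi, ← mul_assoc, h]
  · exact Finset.prod_insert hi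

theorem prod_union_of_mul_self (h : ∀ i, a i * a i = a i) (s t : Finset ι) :
    ∏ j ∈ s ∪ t, a j = (∏ j ∈ s, a j) * ∏ j ∈ t, a j := by
  induction s using Finset.induction_on with
  | empty => simp
  | insert i s _ ih =>
    rw [Finset.insert_union, prod_insert_of_mul_self h, prod_insert_of_mul_self h, ih, mul_assoc]

end IdempotentProd

namespace Bialg.QBialg

open MonTheory CartesianMonoidalCategory FinOrdRel

open scoped MonObj

section Joins

instance : MonObj pt where
  one := unit
  mul := mul
  one_mul := by rw [← cancel_epi (λ_ pt).inv, unit_mul, Iso.inv_hom_id]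
  mul_one := by rw [← cancel_epi (ρ_ pt).inv, mul_unit, Iso.inv_hom_id]
  mul_assoc := mul_assoc

instance : IsCommMonObj pt where
  mul_comm := by
    rw [braiding_pt_pt]
    exact swap_mul

theorem lift_id_id : lift (𝟙 pt) (𝟙 pt) = comul := by
  have h : comul = copyDeleteGenerators.uniformCopyDelete.pair (𝟙 pt) (𝟙 pt) := by
    rw [UniformCopyDelete.pair, id_tensorHom_id, Category.comp_id]
    exact copy_pt.symm
  rw [h]
  apply CartesianMonoidalCategory.hom_ext
  · rw [lift_fst]
    exact (UniformCopyDelete.pair_fst _ _ _).symm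
  · rw [lift_snd]
    exact (UniformCopyDelete.pair_snd _ _ _).symm

theorem hom_mul_self {A : QBialg} (f : A ⟶ pt) : f * f = f := by
  have h : lift f f = f ≫ comul := by rw [← lift_id_id, comp_lift, Category.comp_id]
  rw [Hom.mul_def, h, Category.assoc]
  exact (f ≫= comul_mul).trans (Category.comp_id f)

/-- Recursion on the number of factors of an object of `QBialg`. -/
@[elab_as_elim]
def recPt {P : QBialg → Sort*} (one : P (𝟙_ QBialg)) (cons : ∀ A, P A → P (pt ⊗ A))
    (A : QBialg) : P A :=
  objRec one (fun _ => cons) A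

/-- The number of factors of an object. -/
def len (A : QBialg) : ℕ := FreeMonoid.length A

theorem len_unit : len (𝟙_ QBialg) = 0 := rfl

theorem len_pt : len pt = 1 := rfl

theorem len_tensor (A B : QBialg) : len (A ⊗ B) = len A + len B :=
  FreeMonoid.length_mul A B

theorem len_cons (A : QBialg) : len (pt ⊗ A) = len A + 1 := rfl

/-- The projection of an object onto its `i`-th factor, with junk value `1` if there is none. -/
def proj : ∀ A : QBialg, ℕ → (A ⟶ pt) :=
  recPt (P := fun A => ℕ → (A ⟶ pt)) (fun _ => 1) fun A p i =>
    Nat.casesOn i (fst pt A) fun i => snd pt A ≫ p i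

theorem proj_cons_zero (A : QBialg) : proj (pt ⊗ A) 0 = fst pt A := rfl

theorem proj_cons_succ (A : QBialg) (i : ℕ) : proj (pt ⊗ A) (i + 1) = snd pt A ≫ proj A i := rfl

theorem proj_eq_of_eq {A B : QBialg} (h : A = B) (i : ℕ) : proj A i = eqToHom h ≫ proj B i := by
  subst h
  simp

theorem proj_pt : proj pt 0 = 𝟙 pt := by
  have h : proj pt 0 = (ρ_ pt).inv ≫ proj (pt ⊗ 𝟙_ QBialg) 0 :=
    proj_eq_of_eq (IsStrictMonoidal.tensor_unit pt).symm 0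
  rw [h, proj_cons_zero, rightUnitor_inv_fst]

theorem proj_unit_tensor (B : QBialg) (i : ℕ) :
    proj (𝟙_ QBialg ⊗ B) i = snd (𝟙_ QBialg) B ≫ proj B i := by
  rw [← leftUnitor_hom]
  exact proj_eq_of_eq (IsStrictMonoidal.unit_tensor B) i

theorem proj_cons_tensor (A B : QBialg) (i : ℕ) :
    proj ((pt ⊗ A) ⊗ B) i = (α_ pt A B).hom ≫ proj (pt ⊗ (A ⊗ B)) i :=
  proj_eq_of_eq (IsStrictMonoidal.tensor_assoc pt A B) i

theorem proj_tensor_of_lt {A : QBialg} (B : QBialg) {i : ℕ} (hi : i < len A) :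
    proj (A ⊗ B) i = fst A B ≫ proj A i := by
  induction A using recPt generalizing i with
  | one => exact absurd hi (Nat.not_lt_zero i)
  | cons A ih =>
    refine (proj_cons_tensor A B i).trans ?_
    cases i with
    | zero => exact associator_hom_fst _ _ _
    | succ i =>
      rw [len_cons, Nat.succ_lt_succ_iff] at hi
      rw [proj_cons_succ, ih hi, associator_hom_snd_fst_assoc]
      rfl

theorem proj_tensor_add (A B : QBialg) (i : ℕ) :
    proj (A ⊗ B) (len A + i) = snd A B ≫ proj B i := by
  induction A using recPt with
  | one =>
    rw [len_unit, Nat.zero_add]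
    exact proj_unit_tensor B i
  | cons A ih =>
    rw [len_cons, Nat.add_right_comm]
    refine (proj_cons_tensor A B _).trans ?_
    rw [proj_cons_succ, ih, associator_hom_snd_snd_assoc]

/-- The morphisms to the generating object that are products of projections. -/
def joins (A : QBialg) : Submonoid (A ⟶ pt) :=
  Submonoid.closure (proj A '' Set.Iio (len A))

theorem proj_mem_joins {A : QBialg} {i : ℕ} (hi : i < len A) : proj A i ∈ joins A :=
  Submonoid.subset_closure (Set.mem_image_of_mem _ hi)

theorem comp_mem_joins_of_proj {A B : QBialg} {f : A ⟶ B}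
    (hf : ∀ j < len B, f ≫ proj B j ∈ joins A) {x : B ⟶ pt} (hx : x ∈ joins B) :
    f ≫ x ∈ joins A := by
  induction hx using Submonoid.closure_induction with
  | mem x hx =>
    obtain ⟨j, hj, rfl⟩ := hx
    exact hf j hj
  | one =>
    rw [MonObj.comp_one]
    exact one_mem _
  | mul x y _ _ hx hy =>
    rw [MonObj.comp_mul]
    exact mul_mem hx hy

theorem fst_comp_mem_joins {A B : QBialg} {x : A ⟶ pt} (hx : x ∈ joins A) :
    fst A B ≫ x ∈ joins (A ⊗ B) := by
  refine comp_mem_joins_of_proj (fun j hj => ?_) hx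
  have h : fst A B ≫ proj A j = proj (A ⊗ B) j := by rw [proj_tensor_of_lt B hj]
  rw [h]
  exact proj_mem_joins (by rw [len_tensor]; omega)

theorem snd_comp_mem_joins {A B : QBialg} {x : B ⟶ pt} (hx : x ∈ joins B) :
    snd A B ≫ x ∈ joins (A ⊗ B) := by
  refine comp_mem_joins_of_proj (fun j hj => ?_) hx
  have h : snd A B ≫ proj B j = proj (A ⊗ B) (len A + j) := by
    rw [proj_tensor_add]
  rw [h]
  exact proj_mem_joins (by rw [len_tensor]; omega)

theorem id_mem_joins : 𝟙 pt ∈ joins pt := by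
  rw [← proj_pt]
  exact proj_mem_joins (by rw [len_pt]; omega)

theorem fst_mem_joins : fst pt pt ∈ joins (pt ⊗ pt) := by
  simpa using fst_comp_mem_joins (B := pt) id_mem_joins

theorem snd_mem_joins : snd pt pt ∈ joins (pt ⊗ pt) := by
  simpa using snd_comp_mem_joins (A := pt) id_mem_joins

theorem mul_mem_joins : mul ∈ joins (pt ⊗ pt) := by
  have h : mul = fst pt pt * snd pt pt := by
    rw [Hom.mul_def, lift_fst_snd, Category.id_comp]
    rfl
  rw [h]
  exact mul_mem fst_mem_joins snd_mem_joins

theorem unit_mem_joins : unit ∈ joins (𝟙_ QBialg) := by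
  have h : unit = (1 : 𝟙_ QBialg ⟶ pt) := by
    rw [Hom.one_def, toUnit_unit, Category.id_comp]
    rfl
  rw [h]
  exact one_mem _

theorem comp_mem_joins_of_pt {A : QBialg} {f : A ⟶ pt} (hf : f ∈ joins A) {x : pt ⟶ pt}
    (hx : x ∈ joins pt) : f ≫ x ∈ joins A := by
  refine comp_mem_joins_of_proj (fun j hj => ?_) hx
  obtain rfl : j = 0 := Nat.lt_one_iff.1 hj
  rwa [proj_pt, Category.comp_id]

theorem comp_mem_joins_of_fst_snd {A : QBialg} {f : A ⟶ pt ⊗ pt}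
    (h₁ : f ≫ fst pt pt ∈ joins A) (h₂ : f ≫ snd pt pt ∈ joins A) {x : pt ⊗ pt ⟶ pt}
    (hx : x ∈ joins (pt ⊗ pt)) : f ≫ x ∈ joins A := by
  refine comp_mem_joins_of_proj (fun j hj => ?_) hx
  obtain rfl | rfl : j = 0 ∨ j = 1 := by rw [len_tensor, len_pt] at hj; omega
  · exact h₁
  · rwa [proj_cons_succ, proj_pt, Category.comp_id]

theorem comul_comp_mem_joins {x : pt ⊗ pt ⟶ pt} (hx : x ∈ joins (pt ⊗ pt)) :
    comul ≫ x ∈ joins pt := by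
  rw [← lift_id_id]
  exact comp_mem_joins_of_fst_snd (by rw [lift_fst]; exact id_mem_joins)
    (by rw [lift_snd]; exact id_mem_joins) hx

theorem counit_comp_mem_joins {x : 𝟙_ QBialg ⟶ pt} (hx : x ∈ joins (𝟙_ QBialg)) :
    counit ≫ x ∈ joins pt :=
  comp_mem_joins_of_proj (B := 𝟙_ QBialg) (fun j hj => (Nat.not_lt_zero j hj).elim) hx

theorem swap_comp_mem_joins {x : pt ⊗ pt ⟶ pt} (hx : x ∈ joins (pt ⊗ pt)) :
    swap ≫ x ∈ joins (pt ⊗ pt) := by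
  rw [← braiding_pt_pt]
  exact comp_mem_joins_of_fst_snd (by rw [braiding_hom_fst]; exact snd_mem_joins)
    (by rw [braiding_hom_snd]; exact fst_mem_joins) hx

theorem tensorHom_comp_mem_joins {A B A' B' : QBialg} {f : A ⟶ B} {g : A' ⟶ B'}
    (hf : ∀ x ∈ joins B, f ≫ x ∈ joins A) (hg : ∀ x ∈ joins B', g ≫ x ∈ joins A')
    {x : B ⊗ B' ⟶ pt} (hx : x ∈ joins (B ⊗ B')) : (f ⊗ₘ g) ≫ x ∈ joins (A ⊗ A') := by
  refine comp_mem_joins_of_proj (fun j hj => ?_) hx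
  by_cases hjB : j < len B
  · rw [proj_tensor_of_lt B' hjB, tensorHom_fst_assoc]
    exact fst_comp_mem_joins (hf _ (proj_mem_joins hjB))
  · obtain ⟨k, rfl⟩ := Nat.exists_eq_add_of_le (Nat.le_of_not_lt hjB)
    rw [proj_tensor_add, tensorHom_snd_assoc]
    exact snd_comp_mem_joins (hg _ (proj_mem_joins (by rw [len_tensor] at hj; omega)))

theorem comp_mem_joins {A B : QBialg} (f : A ⟶ B) : ∀ x ∈ joins B, f ≫ x ∈ joins A := by
  induction f using homInd with
  | gen g =>
    intro x hx
    match g with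
    | .mu => exact comp_mem_joins_of_pt mul_mem_joins hx
    | .eta => exact comp_mem_joins_of_pt unit_mem_joins hx
    | .delta => exact comul_comp_mem_joins hx
    | .eps => exact counit_comp_mem_joins hx
    | .gamma => exact swap_comp_mem_joins hx
  | id A =>
    intro x hx
    rwa [Category.id_comp]
  | comp f g hf hg =>
    intro x hx
    rw [Category.assoc]
    exact hf _ (hg x hx)
  | tensor f g hf hg => exact fun x hx => tensorHom_comp_mem_joins hf hg hx

theorem mem_joins {A : QBialg} (f : A ⟶ pt) : f ∈ joins A := by
  simpa using comp_mem_joins f _ id_mem_joins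

theorem exists_eq_prod_proj {A : QBialg} (f : A ⟶ pt) :
    ∃ s ⊆ Finset.range (len A), f = ∏ i ∈ s, proj A i := by
  induction mem_joins f using Submonoid.closure_induction with
  | mem f hf =>
    obtain ⟨i, hi, rfl⟩ := hf
    exact ⟨{i}, by simpa using hi, by simp⟩
  | one => exact ⟨∅, by simp, by simp⟩
  | mul f g _ _ hf hg =>
    obtain ⟨s, hs, rfl⟩ := hf
    obtain ⟨t, ht, rfl⟩ := hg
    exact ⟨s ∪ t, Finset.union_subset hs ht,
      (prod_union_of_mul_self (fun i => hom_mul_self (proj A i)) s t).symm⟩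

theorem hom_ext_proj {A B : QBialg} {f g : A ⟶ B}
    (h : ∀ j < len B, f ≫ proj B j = g ≫ proj B j) : f = g := by
  induction B using recPt with
  | one => exact toUnit_unique f g
  | cons B ih =>
    apply CartesianMonoidalCategory.hom_ext
    · exact h 0 (Nat.succ_pos _)
    · refine ih fun j hj => ?_
      simpa only [Category.assoc, proj_cons_succ] using h (j + 1) (Nat.succ_lt_succ hj)

theorem exists_comp_proj_eq {A : QBialg} (B : QBialg) (v : ℕ → (A ⟶ pt)) :
    ∃ f : A ⟶ B, ∀ j < len B, f ≫ proj B j = v j := by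
  induction B using recPt generalizing v with
  | one => exact ⟨toUnit A, fun j hj => (Nat.not_lt_zero j hj).elim⟩
  | cons B ih =>
    obtain ⟨f, hf⟩ := ih fun j => v (j + 1)
    refine ⟨lift (v 0) f, fun j hj => ?_⟩
    cases j with
    | zero => exact lift_fst _ _
    | succ j =>
      rw [proj_cons_succ, lift_snd_assoc]
      exact hf j (Nat.lt_of_succ_lt_succ hj)

end Joins

section Relations

/-- The interpretation of morphisms of `QBialg` as relations. -/
abbrev toRel : QBialg ⥤ FinOrdRel := relModel.functor

theorem size_toRel_obj (A : QBialg) : (toRel.obj A).size = len A := rfl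

theorem holds_toRel_id {A : QBialg} {i j : ℕ} :
    Holds (toRel.map (𝟙 A)) i j ↔ i < len A ∧ i = j := by
  rw [toRel.map_id, holds_id, size_toRel_obj]

theorem holds_toRel_comp {A B C : QBialg} {f : A ⟶ B} {g : B ⟶ C} {i k : ℕ} :
    Holds (toRel.map (f ≫ g)) i k ↔
      ∃ j < len B, Holds (toRel.map f) i j ∧ Holds (toRel.map g) j k := by
  rw [toRel.map_comp, holds_comp, size_toRel_obj]

theorem holds_toRel_eqToHom {A B : QBialg} (h : A = B) {i j : ℕ} :
    Holds (toRel.map (eqToHom h)) i j ↔ i < len A ∧ i = j := by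
  rw [eqToHom_map, holds_eqToHom, size_toRel_obj]

theorem holds_toRel_tensorHom {A B A' B' : QBialg} {f : A ⟶ B} {g : A' ⟶ B'} {i j : ℕ} :
    Holds (toRel.map (f ⊗ₘ g)) i j ↔ Holds (toRel.map f) i j ∨
      len A ≤ i ∧ len B ≤ j ∧ Holds (toRel.map g) (i - len A) (j - len B) := by
  rw [IsStrictMonoidalFunctor.map_tensorHom, holds_eqToHom_conj, holds_tensorHom, size_toRel_obj,
    size_toRel_obj]

theorem not_holds_toRel_of_hom_unit {A : QBialg} (f : A ⟶ 𝟙_ QBialg) {i j : ℕ} :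
    ¬ Holds (toRel.map f) i j :=
  fun h => Nat.not_lt_zero j h.lt_right

theorem holds_toRel_fst {A B : QBialg} {i j : ℕ} :
    Holds (toRel.map (fst A B)) i j ↔ i < len A ∧ i = j := by
  rw [fst_def, holds_toRel_comp]
  have h (i j : ℕ) : Holds (toRel.map (ρ_ A).hom) i j ↔ i < len (A ⊗ 𝟙_ QBialg) ∧ i = j :=
    holds_toRel_eqToHom (IsStrictMonoidal.tensor_unit A)
  simp only [← id_tensorHom, holds_toRel_tensorHom, h, not_holds_toRel_of_hom_unit,
    holds_toRel_id, len_tensor, len_unit]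
  grind

theorem holds_toRel_snd {A B : QBialg} {i j : ℕ} :
    Holds (toRel.map (snd A B)) i j ↔ i = len A + j ∧ j < len B := by
  rw [snd_def, holds_toRel_comp]
  have h (i j : ℕ) : Holds (toRel.map (λ_ B).hom) i j ↔ i < len (𝟙_ QBialg ⊗ B) ∧ i = j :=
    holds_toRel_eqToHom (IsStrictMonoidal.unit_tensor B)
  simp only [← tensorHom_id, holds_toRel_tensorHom, h, not_holds_toRel_of_hom_unit,
    holds_toRel_id, len_tensor, len_unit]
  grind

theorem holds_toRel_proj {A : QBialg} {i k j : ℕ} (hi : i < len A) :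
    Holds (toRel.map (proj A i)) k j ↔ k = i ∧ j = 0 := by
  induction A using recPt generalizing i k with
  | one => exact absurd hi (Nat.not_lt_zero i)
  | cons A ih =>
    cases i with
    | zero =>
      rw [proj_cons_zero, holds_toRel_fst, len_pt]
      omega
    | succ i =>
      rw [len_cons] at hi
      simp only [proj_cons_succ, holds_toRel_comp, holds_toRel_snd, ih (Nat.lt_of_succ_lt_succ hi),
        len_pt]
      exact ⟨by rintro ⟨_, _, ⟨rfl, _⟩, rfl, rfl⟩; exact ⟨Nat.add_comm _ _, rfl⟩,
        by rintro ⟨rfl, rfl⟩; exact ⟨i, by omega, ⟨Nat.add_comm _ _, by omega⟩, rfl, rfl⟩⟩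

theorem holds_toRel_comp_proj {A B : QBialg} (f : A ⟶ B) {i j : ℕ} (hj : j < len B) :
    Holds (toRel.map (f ≫ proj B j)) i 0 ↔ Holds (toRel.map f) i j := by
  simp only [holds_toRel_comp, holds_toRel_proj hj, and_true]
  exact ⟨by rintro ⟨_, _, h, rfl⟩; exact h, fun h => ⟨j, hj, h, rfl⟩⟩

theorem not_holds_toRel_one {A : QBialg} {i j : ℕ} :
    ¬ Holds (toRel.map (1 : A ⟶ pt)) i j := by
  rw [Hom.one_def, holds_toRel_comp]
  rintro ⟨_, hk, -⟩
  exact Nat.not_lt_zero _ hk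

theorem holds_toRel_mul {k : ℕ} : Holds (toRel.map mul) k 0 ↔ k < 2 :=
  ⟨Holds.lt_left, fun h => ⟨h, Nat.one_pos, trivial⟩⟩

theorem holds_toRel_hom_mul {A : QBialg} {f g : A ⟶ pt} {i : ℕ} :
    Holds (toRel.map (f * g)) i 0 ↔ Holds (toRel.map f) i 0 ∨ Holds (toRel.map g) i 0 := by
  have hf : Holds (toRel.map f) i 0 ↔ Holds (toRel.map (lift f g)) i 0 := by
    rw [← holds_toRel_comp_proj (lift f g) (Nat.succ_pos _), proj_cons_zero, lift_fst]
  have hg : Holds (toRel.map g) i 0 ↔ Holds (toRel.map (lift f g)) i 1 := by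
    rw [← holds_toRel_comp_proj (lift f g) (j := 1) (Nat.lt_succ_self 1), proj_cons_succ,
      lift_snd_assoc, proj_pt, Category.comp_id]
  have h : Holds (toRel.map (f * g)) i 0 ↔
      ∃ k < 2, Holds (toRel.map (lift f g)) i k ∧ Holds (toRel.map mul) k 0 := holds_toRel_comp
  simp only [h, hf, hg, holds_toRel_mul]
  constructor
  · rintro ⟨k, hk, hfg, -⟩
    obtain rfl | rfl : k = 0 ∨ k = 1 := by omega
    exacts [.inl hfg, .inr hfg]
  · rintro (hf | hg)
    exacts [⟨0, two_pos, hf, two_pos⟩, ⟨1, one_lt_two, hg, one_lt_two⟩]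

theorem holds_toRel_prod_proj {A : QBialg} {s : Finset ℕ} (hs : s ⊆ Finset.range (len A)) {i : ℕ} :
    Holds (toRel.map (∏ j ∈ s, proj A j)) i 0 ↔ i ∈ s := by
  induction s using Finset.induction_on with
  | empty => simp [not_holds_toRel_one]
  | insert j s hj ih =>
    obtain ⟨hjA, hs⟩ := Finset.insert_subset_iff.1 hs
    rw [Finset.prod_insert hj, holds_toRel_hom_mul, holds_toRel_proj (Finset.mem_range.1 hjA),
      ih hs, Finset.mem_insert]
    simp only [and_true]

theorem toRel_map_injective_of_pt {A : QBialg} {f g : A ⟶ pt} (h : toRel.map f = toRel.map g) :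
    f = g := by
  obtain ⟨s, hs, rfl⟩ := exists_eq_prod_proj f
  obtain ⟨t, ht, rfl⟩ := exists_eq_prod_proj g
  have hst : s = t := Finset.ext fun i => by
    rw [← holds_toRel_prod_proj hs, h, holds_toRel_prod_proj ht]
  rw [hst]

instance : toRel.Faithful where
  map_injective h := hom_ext_proj fun j _ => toRel_map_injective_of_pt <| by
    rw [toRel.map_comp, toRel.map_comp, h]

instance : toRel.Full where
  map_surjective {A B} R := by
    classical
    let column (j : ℕ) : Finset ℕ := (Finset.range (len A)).filter fun i => Holds R i j
    obtain ⟨f, hf⟩ := exists_comp_proj_eq B fun j => ∏ i ∈ column j, proj A i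
    refine ⟨f, hom_ext_holds fun i hi j hj => ?_⟩
    rw [← holds_toRel_comp_proj f hj, hf j hj, holds_toRel_prod_proj (Finset.filter_subset _ _),
      Finset.mem_filter, Finset.mem_range]
    exact and_iff_right hi

theorem toRel_obj_bijective : Function.Bijective toRel.obj :=
  ⟨fun _ _ h => List.ext_getElem h fun _ _ _ => rfl,
    fun n => ⟨List.replicate n (), List.length_replicate⟩⟩

end Relations

end Bialg.QBialg

theorem mainTheorem3 : Bialg.qualitativeTheory.Presents FinOrdRel :=
  monoidallyEquivalent_of_bijective_obj Bialg.QBialg.toRel Bialg.QBialg.toRel_obj_bijective
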